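/- **Theorem 2.1.** Let $p\in[1,\infty)$, let $G$ be a locally compact group with left Haar measure $\mu$, let $A$ be an $L^p$ operator algebra (a complex Banach algebra admitting an isometric representation on the $L^p$ space of some measure space) that has a two-sided contractive approximate identity, and let $\alpha$ be a homomorphism from $G$ to the group of isometric automorphisms of $A$ such that $t\mapsto\alpha_t(a)$ is continuous for every $a\in A$. A nondegenerate $\sigma$-finite contractive covariant representation of $(G,A,\alpha)$ is a pair $(\pi,v)$ on a space $E=L^p(X,\nu)$ with $\nu$ $\sigma$-finite, where $\pi:A\to\mathcal B(E)$ is a contractive homomorphism that is nondegenerate (the linear span of $\pi(A)E$ is dense in $E$) and $v$ is a strongly continuous representation of $G$ by surjective linear isometries of $E$, such that $v_t\pi(a)v_{t^{-1}}=\pi(\alpha_t(a))$ for all $t\in G$, $a\in A$. Let $C_c(G,A,\alpha)$ be the algebra of continuous compactly supported functions $G\to A$ with product $(f*g)(t)=\int_G f(s)\alpha_s(g(s^{-1}t))\,d\mu(s)$, and put $(\pi\rtimes v)(f)\xi=\int_G\pi(f(t))v_t\xi\,d\mu(t)$ for $f\in C_c(G,A,\alpha)$, $\xi\in E$. The full crossed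 product $F^p(G,A,\alpha)$ is the (Hausdorff) completion of $C_c(G,A,\alpha)$ in the seminorm $\|f\|=\sup\|(\pi\rtimes v)(f)\|$, the supremum being over all nondegenerate $\sigma$-finite contractive covariant representations $(\pi,v)$; each $\pi\rtimes v$ extends by continuity to a contractive homomorphism on $F^p(G,A,\alpha)$, the integrated form of $(\pi,v)$, again denoted $\pi\rtimes v$. Then for every $\sigma$-finite measure space $(X,\nu)$ and every nondegenerate contractive homomorphism $L:F^p(G,A,\alpha)\to\mathcal B(L^p(X,\nu))$ there is a nondegenerate contractive covariant representation $(\pi,v)$ of $(G,A,\alpha)$ on the same space $L^p(X,\nu)$ with $L=\pi\rtimes v$. -/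

import Mathlib

open MeasureTheory Filter Topology
open scoped ENNReal CompactlySupported Pointwise

universe w u v x

/-- `A` is an `L^p` operator algebra: it has an isometric representation on the `L^p` space of
some (arbitrary) measure space. -/
def IsLpOperatorAlgebra.{x', v'} (p : ℝ≥0∞) [Fact (1 ≤ p)] (A : Type v') [NonUnitalNormedRing A]
    [NormedSpace ℂ A] : Prop :=
  ∃ (X : Type x') (_ : MeasurableSpace X) (ν : Measure X)
    (π : A →ₙₐ[ℂ] (Lp ℂ p ν →L[ℂ] Lp ℂ p ν)), ∀ a, ‖π a‖ = ‖a‖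

/-- `A` has a two-sided contractive approximate identity. -/
def HasContractiveApproxIdentity (A : Type*) [NonUnitalNormedRing A] : Prop :=
  ∃ l : Filter A, l.IsApproximateUnit ∧ ∀ᶠ e in l, ‖e‖ ≤ 1

/-- A continuous (for the point-norm topology) homomorphism from `G` to the group of isometric
algebra automorphisms of `A`. -/
structure IsometricAction (G A : Type*) [Group G] [TopologicalSpace G] [NonUnitalNormedRing A]
    [NormedSpace ℂ A] where
  aut : G →* (A ≃ₗᵢ[ℂ] A)
  aut_mul : ∀ (t : G) (a b : A), aut t (a * b) = aut t a * aut t b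
  continuous_aut : ∀ a : A, Continuous fun t => aut t a

section Nondegenerate

variable {B : Type*} [NonUnitalNormedRing B] [NormedSpace ℂ B]
  {E : Type*} [NormedAddCommGroup E] [NormedSpace ℂ E]

/-- A representation `π : B → 𝓑(E)` is nondegenerate if the linear span of
`{π(b)ξ : b ∈ B, ξ ∈ E}` is dense in `E`. -/
def IsNondegenerateRep (π : B →ₙₐ[ℂ] (E →L[ℂ] E)) : Prop :=
  Dense (Submodule.span ℂ {η : E | ∃ (b : B) (ξ : E), η = π b ξ} : Set E)

/-- A representation `π : B → 𝓑(E)` is contractive if `‖π(b)‖ ≤ ‖b‖` for all `b`. -/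
def IsContractiveRep (π : B →ₙₐ[ℂ] (E →L[ℂ] E)) : Prop :=
  ∀ b, ‖π b‖ ≤ ‖b‖

end Nondegenerate

/-- A strongly continuous isometric representation of a group is jointly continuous. -/
theorem continuous_uncurry_isometricRep {G E : Type*} [Group G] [TopologicalSpace G]
    [NormedAddCommGroup E] [NormedSpace ℂ E] (v : G →* (E ≃ₗᵢ[ℂ] E))
    (hv : ∀ ξ, Continuous fun t => v t ξ) : Continuous fun q : G × E => v q.1 q.2 := by
  rw [continuous_iff_continuousAt]
  rintro ⟨t₀, ξ₀⟩
  have h1 : Tendsto (fun q : G × E => ‖q.2 - ξ₀‖ + ‖v q.1 ξ₀ - v t₀ ξ₀‖) (𝓝 (t₀, ξ₀)) (𝓝 0) := by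
    have : Continuous fun q : G × E => ‖q.2 - ξ₀‖ + ‖v q.1 ξ₀ - v t₀ ξ₀‖ := by
      have := (hv ξ₀).comp (continuous_fst (X := G) (Y := E))
      simp only [Function.comp_def] at this
      fun_prop
    simpa using this.tendsto (t₀, ξ₀)
  rw [ContinuousAt, tendsto_iff_norm_sub_tendsto_zero]
  refine squeeze_zero (fun _ => norm_nonneg _) (fun q => ?_) h1
  calc ‖v q.1 q.2 - v t₀ ξ₀‖ = ‖v q.1 (q.2 - ξ₀) + (v q.1 ξ₀ - v t₀ ξ₀)‖ := by
        rw [map_sub]; congr 1; abel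
    _ ≤ ‖v q.1 (q.2 - ξ₀)‖ + ‖v q.1 ξ₀ - v t₀ ξ₀‖ := norm_add_le _ _
    _ = _ := by rw [LinearIsometryEquiv.norm_map]

namespace NonUnitalCompletion

open UniformSpace Completion

variable {R : Type*} [NonUnitalSeminormedRing R]

/-- The multiplication of a (not necessarily unital) seminormed ring, extended by continuity to
the completion. -/
noncomputable instance : Mul (Completion R) :=
  ⟨Function.curry <| (isDenseInducing_coe.prodMap isDenseInducing_coe).extend
    ((↑) ∘ Function.uncurry (· * ·))⟩

theorem coe_mul (a b : R) : ((a * b : R) : Completion R) = a * b :=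
  ((isDenseInducing_coe.prodMap isDenseInducing_coe).extend_eq
    ((continuous_coe R).comp (@continuous_mul R _ _ _)) (a, b)).symm

instance : ContinuousMul (Completion R) where
  continuous_mul := by
    let m := (AddMonoidHom.mul : R →+ R →+ R).compr₂ toCompl
    have : Continuous fun p : R × R => m p.1 p.2 := (continuous_coe R).comp continuous_mul
    have di : IsDenseInducing (toCompl : R → Completion R) := isDenseInducing_coe
    exact (di.extend_Z_bilin di this :)

noncomputable instance instRing : NonUnitalNormedRing (Completion R) :=
  { (inferInstance : NormedAddCommGroup (Completion R)), (inferInstance : Mul (Completion R)) with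
    zero_mul := fun a => Completion.induction_on a (isClosed_eq (by fun_prop) continuous_const)
      fun a => by rw [← coe_zero, ← coe_mul, zero_mul]
    mul_zero := fun a => Completion.induction_on a (isClosed_eq (by fun_prop) continuous_const)
      fun a => by rw [← coe_zero, ← coe_mul, mul_zero]
    mul_assoc := fun a b c => Completion.induction_on₃ a b c
      (isClosed_eq (by fun_prop) (by fun_prop))
      fun a b c => by rw [← coe_mul, ← coe_mul, ← coe_mul, ← coe_mul, mul_assoc]
    left_distrib := fun a b c => Completion.induction_on₃ a b c
      (isClosed_eq (by fun_prop) (by fun_prop))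
      fun a b c => by rw [← coe_add, ← coe_mul, ← coe_mul, ← coe_mul, ← coe_add, mul_add]
    right_distrib := fun a b c => Completion.induction_on₃ a b c
      (isClosed_eq (by fun_prop) (by fun_prop))
      fun a b c => by rw [← coe_add, ← coe_mul, ← coe_mul, ← coe_mul, ← coe_add, add_mul]
    norm_mul_le := fun a b => Completion.induction_on₂ a b
      (isClosed_le (by fun_prop) (by fun_prop))
      fun a b => by rw [← coe_mul]; simpa only [norm_coe] using norm_mul_le a b }

variable [NormedSpace ℂ R] [IsScalarTower ℂ R R] [SMulCommClass ℂ R R]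

instance : IsScalarTower ℂ (Completion R) (Completion R) where
  smul_assoc c a b := Completion.induction_on₂ a b
    (isClosed_eq (((continuous_const_smul c).comp continuous_fst).mul continuous_snd)
      ((continuous_const_smul c).comp continuous_mul))
    fun a b => by
      simp only [smul_eq_mul]
      rw [← coe_smul, ← coe_mul, ← coe_mul, ← coe_smul, smul_mul_assoc]

instance : SMulCommClass ℂ (Completion R) (Completion R) where
  smul_comm c a b := Completion.induction_on₂ a b
    (isClosed_eq ((continuous_const_smul c).comp continuous_mul)
      (continuous_fst.mul ((continuous_const_smul c).comp continuous_snd)))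
    fun a b => by
      simp only [smul_eq_mul]
      rw [← coe_smul, ← coe_mul, ← coe_mul, ← coe_smul, mul_smul_comm]

noncomputable abbrev instSpace (R : Type*) [NonUnitalSeminormedRing R] [NormedSpace ℂ R] :
    NormedSpace ℂ (Completion R) := inferInstance

/-- The canonical homomorphism from `R` to its completion. -/
noncomputable def coeHom : R →ₙₐ[ℂ] Completion R where
  toFun a := a
  map_smul' c a := coe_smul c a
  map_zero' := coe_zero
  map_add' a b := coe_add a b
  map_mul' a b := coe_mul a b

variable {S : Type*} [NonUnitalNormedRing S] [NormedSpace ℂ S] [CompleteSpace S]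

/-- The extension by continuity of a contractive homomorphism to the completion. -/
noncomputable def extendHom (T : R →ₙₐ[ℂ] S) (hT : ∀ a, ‖T a‖ ≤ ‖a‖) : Completion R →ₙₐ[ℂ] S :=
  let T' : R →L[ℂ] S := LinearMap.mkContinuous (T : R →ₗ[ℂ] S) 1 fun a => by simpa using hT a
  { T'.fromCompletion with
    map_zero' := map_zero T'.fromCompletion
    map_mul' := fun a b => Completion.induction_on₂ a b
      (isClosed_eq (T'.fromCompletion.continuous.comp continuous_mul)
        ((T'.fromCompletion.continuous.comp continuous_fst).mul
          (T'.fromCompletion.continuous.comp continuous_snd)))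
      fun a b => by
        change T'.fromCompletion (a * b) = T'.fromCompletion a * T'.fromCompletion b
        rw [← coe_mul]
        simp only [ContinuousLinearMap.fromCompletion_apply_coe]
        exact map_mul T a b }

theorem extendHom_coe (T : R →ₙₐ[ℂ] S) (hT : ∀ a, ‖T a‖ ≤ ‖a‖) (a : R) :
    extendHom T hT a = T a :=
  ContinuousLinearMap.fromCompletion_apply_coe _ a

theorem continuous_extendHom (T : R →ₙₐ[ℂ] S) (hT : ∀ a, ‖T a‖ ≤ ‖a‖) :
    Continuous (extendHom T hT) :=
  ContinuousLinearMap.continuous (ContinuousLinearMap.fromCompletion _)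

end NonUnitalCompletion

section CrossedProduct

variable {G : Type u} {A : Type v} [Group G] [TopologicalSpace G] [IsTopologicalGroup G]
  [LocallyCompactSpace G] [MeasurableSpace G] [BorelSpace G]
  [NonUnitalNormedRing A] [NormedSpace ℂ A] [IsScalarTower ℂ A A] [SMulCommClass ℂ A A]
  [CompleteSpace A]

namespace IsometricAction

theorem continuous_act (α : IsometricAction G A) {Y : Type*} [TopologicalSpace Y]
    {s : Y → G} {f : Y → A} (hs : Continuous s) (hf : Continuous f) :
    Continuous fun y => α.aut (s y) (f y) :=
  (continuous_uncurry_isometricRep α.aut α.continuous_aut).comp (hs.prodMk hf)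

end IsometricAction

/-- The space of continuous compactly supported functions `G → A`. The action `α` and the left
Haar measure `μ` are recorded in the type because the product below (twisted convolution) depends
on them. -/
@[nolint unusedArguments]
def TwistedCc (_α : IsometricAction G A) (_μ : Measure G) : Type _ := C_c(G, A)

namespace TwistedCc

variable {α : IsometricAction G A} {μ : Measure G}

noncomputable instance : AddCommGroup (TwistedCc α μ) := inferInstanceAs (AddCommGroup C_c(G, A))
noncomputable instance : Module ℂ (TwistedCc α μ) := inferInstanceAs (Module ℂ C_c(G, A))
instance : FunLike (TwistedCc α μ) G A := inferInstanceAs (FunLike C_c(G, A) G A)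

theorem continuous (f : TwistedCc α μ) : Continuous f :=
  ContinuousMap.continuous_toFun (CompactlySupportedContinuousMap.toContinuousMap (α := G) (β := A) f)

theorem hasCompactSupport (f : TwistedCc α μ) : HasCompactSupport f :=
  CompactlySupportedContinuousMap.hasCompactSupport' (α := G) (β := A) f

@[ext] theorem ext {f g : TwistedCc α μ} (h : ∀ t, f t = g t) : f = g :=
  DFunLike.ext f g h

@[simp] theorem add_apply (f g : TwistedCc α μ) (t : G) : (f + g) t = f t + g t := rfl
@[simp] theorem smul_apply (c : ℂ) (f : TwistedCc α μ) (t : G) : (c • f) t = c • f t := rfl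
@[simp] theorem zero_apply (t : G) : (0 : TwistedCc α μ) t = 0 := rfl

theorem eq_zero_of_notMem (f : TwistedCc α μ) {t : G} (ht : t ∉ tsupport f) : f t = 0 :=
  image_eq_zero_of_notMem_tsupport ht

theorem conv_kernel_eq_zero (f g : TwistedCc α μ) {s t : G}
    (h : t ∉ tsupport f * tsupport g) (hs : s ∈ tsupport f) : g (s⁻¹ * t) = 0 := by
  apply g.eq_zero_of_notMem
  intro h'
  exact h ⟨s, hs, s⁻¹ * t, h', by simp⟩

theorem integrable_of_factor [IsFiniteMeasureOnCompacts μ] {E : Type*} [NormedAddCommGroup E]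
    (f : TwistedCc α μ) {F : G → E} (hF : Continuous F) (h0 : ∀ t, f t = 0 → F t = 0) :
    Integrable F μ :=
  hF.integrable_of_hasCompactSupport
    (HasCompactSupport.intro f.hasCompactSupport fun t ht => h0 t (f.eq_zero_of_notMem ht))

variable [IsFiniteMeasureOnCompacts μ]

/-- Twisted convolution `(f * g)(t) = ∫ f(s) α_s(g(s⁻¹t)) dμ(s)`. -/
noncomputable instance : Mul (TwistedCc α μ) where
  mul f g :=
    { toFun := fun t => ∫ s, f s * α.aut s (g (s⁻¹ * t)) ∂μ
      continuous_toFun := by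
        rw [← continuousOn_univ]
        refine continuousOn_integral_of_compact_support (k := tsupport f) f.hasCompactSupport
          (Continuous.continuousOn ?_) ?_
        · have hf := f.continuous
          have hg := g.continuous
          have := α.continuous_act (s := fun q : G × G => q.2)
            (f := fun q : G × G => g (q.2⁻¹ * q.1)) (by fun_prop) (by fun_prop)
          simp only [Function.uncurry_def]
          fun_prop
        · intro t s _ hs
          simp [f.eq_zero_of_notMem hs]
      hasCompactSupport' := by
        refine HasCompactSupport.intro (f.hasCompactSupport.isCompact.mul g.hasCompactSupport) ?_
        intro t ht
        refine integral_eq_zero_of_ae (Eventually.of_forall fun s => ?_)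
        by_cases hs : s ∈ tsupport f
        · simp [conv_kernel_eq_zero f g ht hs]
        · simp [f.eq_zero_of_notMem hs] }

theorem mul_apply (f g : TwistedCc α μ) (t : G) :
    (f * g) t = ∫ s, f s * α.aut s (g (s⁻¹ * t)) ∂μ := rfl

theorem continuous_twist (g : TwistedCc α μ) {Y : Type*} [TopologicalSpace Y] {a b : Y → G}
    (ha : Continuous a) (hb : Continuous b) : Continuous fun y => α.aut (a y) (g (b y)) :=
  α.continuous_act ha (g.continuous.comp hb)

theorem integrable_conv (f g : TwistedCc α μ) (t : G) :
    Integrable (fun s => f s * α.aut s (g (s⁻¹ * t))) μ :=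
  f.integrable_of_factor
    (f.continuous.mul (g.continuous_twist continuous_id (by fun_prop))) fun s hs => by simp [hs]

theorem mul_assoc_aux [μ.IsMulLeftInvariant] (f g h : TwistedCc α μ) :
    f * g * h = f * (g * h) := by
  ext t
  have step : ∀ r, f r * α.aut r ((g * h) (r⁻¹ * t)) =
      ∫ s, f r * (α.aut r (g (r⁻¹ * s)) * α.aut s (h (s⁻¹ * t))) ∂μ := by
    intro r
    let T : A →L[ℂ] A :=
      (ContinuousLinearMap.mul ℂ A (f r)).comp (α.aut r).toContinuousLinearEquiv.toContinuousLinearMap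
    have h1 : f r * α.aut r ((g * h) (r⁻¹ * t)) = T ((g * h) (r⁻¹ * t)) := rfl
    rw [h1, mul_apply, ← T.integral_comp_comm (integrable_conv g h _),
      ← integral_mul_left_eq_self
        (fun s => f r * (α.aut r (g (r⁻¹ * s)) * α.aut s (h (s⁻¹ * t)))) r]
    congr 1 with s
    simp only [T, ContinuousLinearMap.comp_apply, ContinuousLinearMap.mul_apply',
      ContinuousLinearEquiv.coe_coe, LinearIsometryEquiv.coe_toContinuousLinearEquiv, α.aut_mul,
      map_mul, LinearIsometryEquiv.coe_mul, Function.comp_apply, inv_mul_cancel_left, mul_inv_rev, mul_assoc]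
  calc (f * g * h) t
      = ∫ s, (∫ r, f r * (α.aut r (g (r⁻¹ * s)) * α.aut s (h (s⁻¹ * t))) ∂μ) ∂μ := by
        rw [mul_apply]
        congr 1 with s
        have := ((ContinuousLinearMap.mul ℂ A).flip (α.aut s (h (s⁻¹ * t)))).integral_comp_comm
          (integrable_conv f g s)
        simp only [ContinuousLinearMap.flip_apply, ContinuousLinearMap.mul_apply'] at this
        rw [mul_apply, ← this]
        simp only [mul_assoc]
    _ = ∫ r, (∫ s, f r * (α.aut r (g (r⁻¹ * s)) * α.aut s (h (s⁻¹ * t))) ∂μ) ∂μ := by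
        refine integral_integral_swap_of_hasCompactSupport
          (f := fun s r => f r * (α.aut r (g (r⁻¹ * s)) * α.aut s (h (s⁻¹ * t)))) ?_ ?_
        · simp only [Function.uncurry_def]
          exact (f.continuous.comp continuous_snd).mul
            ((g.continuous_twist continuous_snd (by fun_prop)).mul
              (h.continuous_twist continuous_fst (by fun_prop)))
        · refine HasCompactSupport.intro
            ((f.hasCompactSupport.isCompact.mul g.hasCompactSupport).prod f.hasCompactSupport) ?_
          rintro ⟨s, r⟩ hsr
          by_cases hr : r ∈ tsupport f
          · have hs : s ∉ tsupport f * tsupport g := fun hs => hsr ⟨hs, hr⟩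
            simp [conv_kernel_eq_zero f g hs hr]
          · simp [f.eq_zero_of_notMem hr]
    _ = (f * (g * h)) t := by
        rw [mul_apply]
        exact integral_congr_ae (Eventually.of_forall fun r => (step r).symm)

noncomputable instance [μ.IsMulLeftInvariant] : NonUnitalRing (TwistedCc α μ) where
  left_distrib f g h := by
    ext t
    simp only [add_apply, mul_apply, map_add, mul_add]
    exact integral_add (integrable_conv f g t) (integrable_conv f h t)
  right_distrib f g h := by
    ext t
    simp only [add_apply, mul_apply, add_mul]
    exact integral_add (integrable_conv f h t) (integrable_conv g h t)
  zero_mul f := by ext t; simp [mul_apply]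
  mul_zero f := by ext t; simp [mul_apply]
  mul_assoc := mul_assoc_aux

instance [μ.IsMulLeftInvariant] : IsScalarTower ℂ (TwistedCc α μ) (TwistedCc α μ) where
  smul_assoc c f g := by
    ext t
    simp only [smul_eq_mul, smul_apply, mul_apply, smul_mul_assoc, integral_smul]

instance [μ.IsMulLeftInvariant] : SMulCommClass ℂ (TwistedCc α μ) (TwistedCc α μ) where
  smul_comm c f g := by
    ext t
    simp only [smul_eq_mul, smul_apply, mul_apply, map_smul, mul_smul_comm, integral_smul]

end TwistedCc

/-- A nondegenerate contractive covariant representation `(π, v)` of `(G, A, α)` on the space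
`L^p(X, ν)`. It is `σ`-finite when `ν` is. -/
structure CovariantRep (p : ℝ≥0∞) [Fact (1 ≤ p)] (α : IsometricAction G A)
    {X : Type*} [MeasurableSpace X] (ν : Measure X) where
  π : A →ₙₐ[ℂ] (Lp ℂ p ν →L[ℂ] Lp ℂ p ν)
  contractive : IsContractiveRep π
  nondegenerate : IsNondegenerateRep π
  v : G →* (Lp ℂ p ν ≃ₗᵢ[ℂ] Lp ℂ p ν)
  continuous_v : ∀ ξ, Continuous fun t => v t ξ
  covariant : ∀ (t : G) (a : A) (ξ : Lp ℂ p ν), v t (π a (v t⁻¹ ξ)) = π (α.aut t a) ξ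

namespace CovariantRep

variable {p : ℝ≥0∞} [Fact (1 ≤ p)] {α : IsometricAction G A} {μ : Measure G}
  {X : Type*} [MeasurableSpace X] {ν : Measure X}

/-- `π` as a continuous linear map. -/
noncomputable def πL (R : CovariantRep p α ν) : A →L[ℂ] (Lp ℂ p ν →L[ℂ] Lp ℂ p ν) :=
  LinearMap.mkContinuous (R.π : A →ₗ[ℂ] (Lp ℂ p ν →L[ℂ] Lp ℂ p ν)) 1
    fun a => by simpa using R.contractive a

@[simp] theorem πL_apply (R : CovariantRep p α ν) (a : A) : R.πL a = R.π a := rfl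

theorem continuous_integrand (R : CovariantRep p α ν) {Y : Type*} [TopologicalSpace Y] {a : Y → A}
    {s : Y → G} {ξ : Y → Lp ℂ p ν} (ha : Continuous a) (hs : Continuous s) (hξ : Continuous ξ) :
    Continuous fun y => R.π (a y) (R.v (s y) (ξ y)) :=
  (R.πL.continuous.comp ha).clm_apply
    ((continuous_uncurry_isometricRep R.v R.continuous_v).comp (hs.prodMk hξ))

theorem norm_integrand_le (R : CovariantRep p α ν) (a : A) (t : G) (ξ : Lp ℂ p ν) :
    ‖R.π a (R.v t ξ)‖ ≤ ‖a‖ * ‖ξ‖ := by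
  calc ‖R.π a (R.v t ξ)‖ ≤ ‖R.π a‖ * ‖R.v t ξ‖ := ContinuousLinearMap.le_opNorm _ _
    _ ≤ ‖a‖ * ‖ξ‖ := by
      rw [LinearIsometryEquiv.norm_map]
      exact mul_le_mul_of_nonneg_right (R.contractive a) (norm_nonneg _)

theorem π_v_mul (R : CovariantRep p α ν) (a b : A) (s t : G) (ξ : Lp ℂ p ν) :
    R.π (a * α.aut s b) (R.v (s * t) ξ) = R.π a (R.v s (R.π b (R.v t ξ))) := by
  have h : R.v s⁻¹ (R.v (s * t) ξ) = R.v t ξ := by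
    rw [← Function.comp_apply (f := R.v s⁻¹), ← LinearIsometryEquiv.coe_mul, ← map_mul,
      inv_mul_cancel_left]
  rw [map_mul, mul_apply_eq_comp, ← R.covariant s b, h]

variable [IsFiniteMeasureOnCompacts μ]

theorem integrable_integrand (R : CovariantRep p α ν) (f : TwistedCc α μ) (ξ : Lp ℂ p ν) :
    Integrable (fun t => R.π (f t) (R.v t ξ)) μ :=
  f.integrable_of_factor (R.continuous_integrand f.continuous continuous_id continuous_const)
    fun t ht => by simp [ht]

/-- The operator `(π ⋊ v)(f)`, given by `(π ⋊ v)(f)ξ = ∫ π(f(t)) v_t(ξ) dμ(t)`. -/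
noncomputable def integrated (R : CovariantRep p α ν) (f : TwistedCc α μ) :
    Lp ℂ p ν →L[ℂ] Lp ℂ p ν :=
  LinearMap.mkContinuous
    { toFun := fun ξ => ∫ t, R.π (f t) (R.v t ξ) ∂μ
      map_add' := fun ξ η => by
        simp only [map_add]
        exact integral_add (R.integrable_integrand f ξ) (R.integrable_integrand f η)
      map_smul' := fun c ξ => by
        simp only [map_smul, integral_smul, RingHom.id_apply] }
    (∫ t, ‖f t‖ ∂μ)
    (fun ξ => by
      rw [← integral_mul_const]
      refine norm_integral_le_of_norm_le ?_
        (Eventually.of_forall fun t => R.norm_integrand_le (f t) t ξ)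
      exact (f.integrable_of_factor f.continuous.norm fun t ht => by simp [ht]).mul_const _)

theorem integrated_apply (R : CovariantRep p α ν) (f : TwistedCc α μ) (ξ : Lp ℂ p ν) :
    R.integrated f ξ = ∫ t, R.π (f t) (R.v t ξ) ∂μ := rfl

theorem norm_integrated_le (R : CovariantRep p α ν) (f : TwistedCc α μ) :
    ‖R.integrated f‖ ≤ ∫ t, ‖f t‖ ∂μ :=
  LinearMap.mkContinuous_norm_le _ (integral_nonneg fun _ => norm_nonneg _) _

theorem integrated_add (R : CovariantRep p α ν) (f g : TwistedCc α μ) :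
    R.integrated (f + g) = R.integrated f + R.integrated g := by
  ext1 ξ
  simp only [_root_.add_apply, integrated_apply, TwistedCc.add_apply, map_add]
  exact integral_add (R.integrable_integrand f ξ) (R.integrable_integrand g ξ)

theorem integrated_smul (R : CovariantRep p α ν) (c : ℂ) (f : TwistedCc α μ) :
    R.integrated (c • f) = c • R.integrated f := by
  ext1 ξ
  simp only [_root_.smul_apply, integrated_apply, TwistedCc.smul_apply, map_smul,
    integral_smul]

theorem integrated_mul [μ.IsMulLeftInvariant] (R : CovariantRep p α ν) (f g : TwistedCc α μ) :
    R.integrated (f * g) = R.integrated f * R.integrated g := by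
  ext1 ξ
  calc R.integrated (f * g) ξ
      = ∫ t, (∫ s, R.π (f s * α.aut s (g (s⁻¹ * t))) (R.v t ξ) ∂μ) ∂μ := by
        rw [integrated_apply]
        congr 1 with t : 1
        exact ((R.πL.flip (R.v t ξ)).integral_comp_comm (TwistedCc.integrable_conv f g t)).symm
    _ = ∫ s, (∫ t, R.π (f s * α.aut s (g (s⁻¹ * t))) (R.v t ξ) ∂μ) ∂μ := by
        refine integral_integral_swap_of_hasCompactSupport
          (f := fun t s => R.π (f s * α.aut s (g (s⁻¹ * t))) (R.v t ξ)) ?_ ?_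
        · simp only [Function.uncurry_def]
          exact R.continuous_integrand ((f.continuous.comp continuous_snd).mul
            (g.continuous_twist continuous_snd (by fun_prop))) continuous_fst continuous_const
        · refine HasCompactSupport.intro
            ((f.hasCompactSupport.isCompact.mul g.hasCompactSupport).prod f.hasCompactSupport) ?_
          rintro ⟨t, s⟩ hts
          by_cases hs : s ∈ tsupport f
          · have ht : t ∉ tsupport f * tsupport g := fun ht => hts ⟨ht, hs⟩
            simp [TwistedCc.conv_kernel_eq_zero f g ht hs]
          · simp [f.eq_zero_of_notMem hs]
    _ = ∫ s, R.π (f s) (R.v s (R.integrated g ξ)) ∂μ := by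
        congr 1 with s : 1
        let T : Lp ℂ p ν →L[ℂ] Lp ℂ p ν :=
          (R.π (f s)).comp (R.v s).toContinuousLinearEquiv.toContinuousLinearMap
        have h1 : R.π (f s) (R.v s (R.integrated g ξ)) = T (R.integrated g ξ) := rfl
        rw [h1, integrated_apply, ← T.integral_comp_comm (R.integrable_integrand g ξ),
          ← integral_mul_left_eq_self
            (fun t => R.π (f s * α.aut s (g (s⁻¹ * t))) (R.v t ξ)) s]
        congr 1 with t : 1
        rw [inv_mul_cancel_left, π_v_mul]
        rfl
    _ = (R.integrated f * R.integrated g) ξ := rfl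

end CovariantRep

/-- The values `‖(π ⋊ v)(f)‖`, where `(π, v)` ranges over all nondegenerate `σ`-finite contractive
covariant representations of `(G, A, α)` on `L^p` spaces. -/
def repNorms (p : ℝ≥0∞) [Fact (1 ≤ p)] {α : IsometricAction G A} {μ : Measure G}
    [IsFiniteMeasureOnCompacts μ] (f : TwistedCc α μ) : Set ℝ :=
  {r | ∃ (X : Type w) (_ : MeasurableSpace X) (ν : Measure X) (_ : SigmaFinite ν)
    (R : CovariantRep p α ν), r = ‖R.integrated f‖}

section Norm

variable {p : ℝ≥0∞} [Fact (1 ≤ p)] {α : IsometricAction G A} {μ : Measure G}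
  [IsFiniteMeasureOnCompacts μ]

/-- The norm `‖f‖ = sup ‖(π ⋊ v)(f)‖` on `C_c(G, A, α)`. -/
noncomputable def fpNorm (p : ℝ≥0∞) [Fact (1 ≤ p)] (f : TwistedCc α μ) : ℝ :=
  sSup (repNorms.{w} p f)

theorem norm_integrated_le_fpNorm {X : Type w} [MeasurableSpace X] {ν : Measure X}
    [hν : SigmaFinite ν] (R : CovariantRep p α ν) (f : TwistedCc α μ) :
    ‖R.integrated f‖ ≤ fpNorm.{w} p f := by
  refine le_csSup ⟨∫ t, ‖f t‖ ∂μ, ?_⟩ ⟨X, _, ν, hν, R, rfl⟩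
  rintro r ⟨_, _, _, _, R, rfl⟩
  exact R.norm_integrated_le f

theorem fpNorm_nonneg (f : TwistedCc α μ) : 0 ≤ fpNorm.{w} p f := by
  refine Real.sSup_nonneg ?_
  rintro r ⟨_, _, _, _, R, rfl⟩
  exact norm_nonneg _

theorem fpNorm_le (f : TwistedCc α μ) {c : ℝ} (hc : 0 ≤ c)
    (h : ∀ (X : Type w) [MeasurableSpace X] (ν : Measure X) [SigmaFinite ν]
      (R : CovariantRep p α ν), ‖R.integrated f‖ ≤ c) : fpNorm.{w} p f ≤ c := by
  refine Real.sSup_le ?_ hc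
  rintro r ⟨X, _, ν, _, R, rfl⟩
  exact h X ν R

theorem fpNorm_add_le (f g : TwistedCc α μ) :
    fpNorm.{w} p (f + g) ≤ fpNorm.{w} p f + fpNorm.{w} p g := by
  refine fpNorm_le _ (add_nonneg (fpNorm_nonneg f) (fpNorm_nonneg g)) fun X _ ν _ R => ?_
  rw [R.integrated_add]
  exact (norm_add_le _ _).trans
    (add_le_add (norm_integrated_le_fpNorm R f) (norm_integrated_le_fpNorm R g))

theorem fpNorm_smul_le (c : ℂ) (f : TwistedCc α μ) :
    fpNorm.{w} p (c • f) ≤ ‖c‖ * fpNorm.{w} p f := by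
  refine fpNorm_le _ (mul_nonneg (norm_nonneg c) (fpNorm_nonneg f)) fun X _ ν _ R => ?_
  rw [R.integrated_smul, norm_smul]
  exact mul_le_mul_of_nonneg_left (norm_integrated_le_fpNorm R f) (norm_nonneg c)

theorem fpNorm_mul_le [μ.IsMulLeftInvariant] (f g : TwistedCc α μ) :
    fpNorm.{w} p (f * g) ≤ fpNorm.{w} p f * fpNorm.{w} p g := by
  refine fpNorm_le _ (mul_nonneg (fpNorm_nonneg f) (fpNorm_nonneg g)) fun X _ ν _ R => ?_
  rw [R.integrated_mul]
  exact (norm_mul_le _ _).trans (mul_le_mul (norm_integrated_le_fpNorm R f)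
    (norm_integrated_le_fpNorm R g) (norm_nonneg _) (fpNorm_nonneg f))

theorem fpNorm_neg (f : TwistedCc α μ) : fpNorm.{w} p (-f) = fpNorm.{w} p f := by
  have h : ∀ g : TwistedCc α μ, fpNorm.{w} p (-g) ≤ fpNorm.{w} p g := fun g => by
    simpa using fpNorm_smul_le (-1) g
  exact le_antisymm (h f) (by simpa using h (-f))

theorem fpNorm_zero : fpNorm.{w} p (0 : TwistedCc α μ) = 0 :=
  le_antisymm (by simpa using fpNorm_smul_le.{w} (p := p) 0 (0 : TwistedCc α μ)) (fpNorm_nonneg _)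

/-- `fpNorm` as a seminorm on the additive group `C_c(G, A, α)`. -/
noncomputable def fpGroupSeminorm (p : ℝ≥0∞) [Fact (1 ≤ p)] (α : IsometricAction G A)
    (μ : Measure G) [IsFiniteMeasureOnCompacts μ] : AddGroupSeminorm (TwistedCc α μ) where
  toFun := fpNorm.{w} p
  map_zero' := fpNorm_zero
  add_le' := fpNorm_add_le
  neg' := fpNorm_neg

/-- `C_c(G, A, α)` as a seminormed algebra under the norm `fpNorm`. -/
noncomputable abbrev fpSeminormedRing (p : ℝ≥0∞) [Fact (1 ≤ p)] (α : IsometricAction G A)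
    (μ : Measure G) [IsFiniteMeasureOnCompacts μ] [μ.IsMulLeftInvariant] :
    NonUnitalSeminormedRing (TwistedCc α μ) where
  toNonUnitalRing := inferInstance
  norm := fpNorm.{w} p
  toPseudoMetricSpace :=
    (fpGroupSeminorm.{w} p α μ).toSeminormedAddCommGroup.toPseudoMetricSpace
  dist_eq := (fpGroupSeminorm.{w} p α μ).toSeminormedAddCommGroup.dist_eq
  norm_mul_le := fpNorm_mul_le

noncomputable abbrev fpNormedSpace (p : ℝ≥0∞) [Fact (1 ≤ p)] (α : IsometricAction G A)
    (μ : Measure G) [IsFiniteMeasureOnCompacts μ] [μ.IsMulLeftInvariant] :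
    letI := fpSeminormedRing.{w} p α μ
    NormedSpace ℂ (TwistedCc α μ) :=
  letI := fpSeminormedRing.{w} p α μ
  { toModule := inferInstance
    norm_smul_le := fpNorm_smul_le }

end Norm

/-- The full `L^p` operator crossed product `F^p(G, A, α)`: the completion of `C_c(G, A, α)` in the
norm `fpNorm`. -/
def FpCrossedProduct (p : ℝ≥0∞) [Fact (1 ≤ p)] (α : IsometricAction G A) (μ : Measure G)
    [IsFiniteMeasureOnCompacts μ] [μ.IsMulLeftInvariant] : Type (max u v) :=
  letI := fpSeminormedRing.{w} p α μ
  UniformSpace.Completion (TwistedCc α μ)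

section FpCrossedProduct

variable {p : ℝ≥0∞} [Fact (1 ≤ p)] {α : IsometricAction G A} {μ : Measure G}
  [IsFiniteMeasureOnCompacts μ] [μ.IsMulLeftInvariant]

noncomputable instance : NonUnitalNormedRing (FpCrossedProduct.{w} p α μ) :=
  @NonUnitalCompletion.instRing (TwistedCc α μ) (fpSeminormedRing.{w} p α μ)

noncomputable instance : NormedSpace ℂ (FpCrossedProduct.{w} p α μ) :=
  @NonUnitalCompletion.instSpace (TwistedCc α μ) (fpSeminormedRing.{w} p α μ)
    (fpNormedSpace.{w} p α μ)

instance : IsScalarTower ℂ (FpCrossedProduct.{w} p α μ) (FpCrossedProduct.{w} p α μ) := by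
  let := fpSeminormedRing.{w} p α μ
  let := fpNormedSpace.{w} p α μ
  have h : IsScalarTower ℂ (UniformSpace.Completion (TwistedCc α μ))
    (UniformSpace.Completion (TwistedCc α μ)) := inferInstance
  exact h

instance : SMulCommClass ℂ (FpCrossedProduct.{w} p α μ) (FpCrossedProduct.{w} p α μ) := by
  let := fpSeminormedRing.{w} p α μ
  let := fpNormedSpace.{w} p α μ
  have h : SMulCommClass ℂ (UniformSpace.Completion (TwistedCc α μ))
    (UniformSpace.Completion (TwistedCc α μ)) := inferInstance
  exact h

instance : CompleteSpace (FpCrossedProduct.{w} p α μ) := by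
  let := fpSeminormedRing.{w} p α μ
  have h : CompleteSpace (UniformSpace.Completion (TwistedCc α μ)) := inferInstance
  exact h

namespace FpCrossedProduct

/-- The canonical homomorphism `C_c(G, A, α) → F^p(G, A, α)`. -/
noncomputable def ofCc (p : ℝ≥0∞) [Fact (1 ≤ p)] (α : IsometricAction G A) (μ : Measure G)
    [IsFiniteMeasureOnCompacts μ] [μ.IsMulLeftInvariant] :
    TwistedCc α μ →ₙₐ[ℂ] FpCrossedProduct.{w} p α μ :=
  letI := fpSeminormedRing.{w} p α μ
  letI := fpNormedSpace.{w} p α μ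
  NonUnitalCompletion.coeHom

theorem norm_ofCc (f : TwistedCc α μ) : ‖ofCc.{w} p α μ f‖ = fpNorm.{w} p f :=
  letI := fpSeminormedRing.{w} p α μ
  UniformSpace.Completion.norm_coe f

theorem denseRange_ofCc : DenseRange (ofCc.{w} p α μ) :=
  letI := fpSeminormedRing.{w} p α μ
  UniformSpace.Completion.denseRange_coe

end FpCrossedProduct

namespace CovariantRep

variable {X : Type w} [MeasurableSpace X] {ν : Measure X}

/-- The integrated form `π ⋊ v` as a homomorphism on `C_c(G, A, α)`. -/
noncomputable def integratedCc (R : CovariantRep p α ν) :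
    TwistedCc α μ →ₙₐ[ℂ] (Lp ℂ p ν →L[ℂ] Lp ℂ p ν) where
  toFun := R.integrated
  map_smul' := R.integrated_smul
  map_zero' := by simpa using R.integrated_smul 0 (0 : TwistedCc α μ)
  map_add' := R.integrated_add
  map_mul' := R.integrated_mul

/-- The integrated form `π ⋊ v`, extended by continuity to `F^p(G, A, α)`. -/
noncomputable def integratedForm [SigmaFinite ν] (R : CovariantRep p α ν) (μ : Measure G)
    [IsFiniteMeasureOnCompacts μ] [μ.IsMulLeftInvariant] :
    FpCrossedProduct.{w} p α μ →ₙₐ[ℂ] (Lp ℂ p ν →L[ℂ] Lp ℂ p ν) :=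
  letI := fpSeminormedRing.{w} p α μ
  letI := fpNormedSpace.{w} p α μ
  NonUnitalCompletion.extendHom R.integratedCc (norm_integrated_le_fpNorm R)

theorem integratedForm_ofCc [SigmaFinite ν] (R : CovariantRep p α ν) (f : TwistedCc α μ) :
    R.integratedForm μ (FpCrossedProduct.ofCc.{w} p α μ f) = R.integrated f := by
  let := fpSeminormedRing.{w} p α μ
  let := fpNormedSpace.{w} p α μ
  have h := NonUnitalCompletion.extendHom_coe R.integratedCc (norm_integrated_le_fpNorm R) f
  exact h

theorem continuous_integratedForm [SigmaFinite ν] (R : CovariantRep p α ν) :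
    Continuous (R.integratedForm μ) := by
  let := fpSeminormedRing.{w} p α μ
  let := fpNormedSpace.{w} p α μ
  have hT : ∀ f : TwistedCc α μ, ‖R.integratedCc f‖ ≤ ‖f‖ := norm_integrated_le_fpNorm R
  have h := NonUnitalCompletion.continuous_extendHom (R := TwistedCc α μ)
    (T := R.integratedCc) hT
  exact h

theorem norm_integratedForm_le [SigmaFinite ν] (R : CovariantRep p α ν)
    (x : FpCrossedProduct.{w} p α μ) : ‖R.integratedForm μ x‖ ≤ ‖x‖ := by
  refine FpCrossedProduct.denseRange_ofCc.induction_on x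
    (isClosed_le R.continuous_integratedForm.norm continuous_norm) fun f => ?_
  rw [integratedForm_ofCc, FpCrossedProduct.norm_ofCc]
  exact norm_integrated_le_fpNorm R f

end CovariantRep

end FpCrossedProduct

end CrossedProduct

/-!
A nondegenerate contractive representation of a Banach algebra with a contractive left approximate
identity extends to the left multiplier algebra by `T (L(b)ξ) = L(T b)ξ`: the operator of `T` is the
strong limit of the `L(T e)` as `e` runs through the approximate identity, so its norm is at most
`‖T‖`.

Pointwise multiplication by `A` and twisted translation by `G` on `C_c(G, A, α)` yield homomorphisms
`ι_A` and `ι_G` into the left multipliers of `F^p(G, A, α)`, related by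
`ι_G(t) ι_A(a) ι_G(t⁻¹) = ι_A(α_t(a))` and `f = ∫ ι_A(f(t)) ι_G(t) dμ(t)`. By the second relation
the functions `φ ⊗ e`, with `φ` a bump density concentrating at the identity of `G` and `e` in an
approximate identity of `A`, form a contractive left approximate identity of `F^p(G, A, α)`.
Composing the extension of `L` with `ι_A` and `ι_G` gives `π` and `v`.
-/

section StrongConvergence

theorem tendstoUniformlyOn_of_forall_tendsto_nhds {ι X Y : Type*} [TopologicalSpace X]
    [UniformSpace Y] {H : ι → X → Y} {f : X → Y} {l : Filter ι} {K : Set X} (hK : IsCompact K)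
    (hf : Continuous f)
    (h : ∀ t ∈ K, Tendsto (fun q : ι × X => H q.1 q.2) (l ×ˢ 𝓝 t) (𝓝 (f t))) :
    TendstoUniformlyOn H f l K := by
  rw [← tendstoLocallyUniformlyOn_iff_tendstoUniformlyOn_of_compact hK,
    tendstoLocallyUniformlyOn_iff_forall_tendsto]
  intro t ht
  have hft : Tendsto (fun q : ι × X => f q.2) (l ×ˢ 𝓝[K] t) (𝓝 (f t)) :=
    (hf.tendsto t).comp (tendsto_snd.mono_right nhdsWithin_le_nhds)
  have hHt := (h t ht).mono_left (prod_mono_right l (nhdsWithin_le_nhds (s := K)))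
  exact (hft.prodMk_nhds hHt).mono_right (nhds_le_uniformity (f t))

variable {𝕜 E F ι : Type*} [NontriviallyNormedField 𝕜] [NormedAddCommGroup E] [NormedSpace 𝕜 E]
  [NormedAddCommGroup F] [NormedSpace 𝕜 F] {l : Filter ι} {T : ι → E →L[𝕜] F} {C : ℝ}

theorem tendsto_clm_apply_of_eventually_norm_le {u : ι → E} {x : E} {y : F}
    (hT : ∀ᶠ i in l, ‖T i‖ ≤ C) (hu : Tendsto u l (𝓝 x))
    (hx : Tendsto (fun i => T i x) l (𝓝 y)) : Tendsto (fun i => T i (u i)) l (𝓝 y) := by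
  have hbound : ∀ᶠ i in l, ‖T i (u i - x)‖ ≤ C * ‖u i - x‖ :=
    hT.mono fun i hi => (T i).le_of_opNorm_le hi _
  have hdiff : Tendsto (fun i => T i (u i - x)) l (𝓝 0) :=
    squeeze_zero_norm' hbound (by simpa using (tendsto_iff_norm_sub_tendsto_zero.1 hu).const_mul C)
  simpa using hdiff.add hx

theorem tendsto_clm_apply_of_dense_span {S : E →L[𝕜] F} {D : Set E}
    (hT : ∀ᶠ i in l, ‖T i‖ ≤ C) (hD : Dense (Submodule.span 𝕜 D : Set E))
    (h : ∀ x ∈ D, Tendsto (fun i => T i x) l (𝓝 (S x))) (x : E) :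
    Tendsto (fun i => T i x) l (𝓝 (S x)) := by
  have hspan : ∀ z ∈ Submodule.span 𝕜 D, Tendsto (fun i => T i z) l (𝓝 (S z)) := fun z hz => by
    induction hz using Submodule.span_induction with
    | mem z hz => exact h z hz
    | zero => simpa using tendsto_const_nhds
    | add y z _ _ hy hz => simpa using hy.add hz
    | smul c z _ hz => simpa using hz.const_smul c
  rw [Metric.tendsto_nhds]
  intro ε hε
  have hU : IsOpen {z | max C 0 * dist x z + dist (S z) (S x) < ε / 2} :=
    isOpen_lt (by fun_prop) continuous_const
  obtain ⟨z, hz, hzx⟩ := hD.exists_mem_open hU ⟨x, by simpa using half_pos hε⟩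
  filter_upwards [hT, Metric.tendsto_nhds.1 (hspan z hz) _ (half_pos hε)] with i hTi hzi
  have hi : dist (T i x) (T i z) ≤ max C 0 * dist x z := by
    rw [dist_eq_norm, dist_eq_norm, ← map_sub]
    exact (T i).le_of_opNorm_le (hTi.trans (le_max_left C 0)) _
  calc dist (T i x) (S x)
      ≤ dist (T i x) (T i z) + dist (T i z) (S z) + dist (S z) (S x) := dist_triangle4 _ _ _ _
    _ < ε := by linarith [hzx.out]

end StrongConvergence

section LeftMultipliers

/-- `B` has a left approximate identity contained in its closed unit ball, given as a filter. -/
def HasContractiveLeftApproxIdentity (B : Type*) [NonUnitalNormedRing B] : Prop :=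
  ∃ l : Filter B, l.NeBot ∧ (∀ b, Tendsto (· * b) l (𝓝 b)) ∧ ∀ᶠ e in l, ‖e‖ ≤ 1

theorem HasContractiveApproxIdentity.hasContractiveLeftApproxIdentity {B : Type*}
    [NonUnitalNormedRing B] (hB : HasContractiveApproxIdentity B) :
    HasContractiveLeftApproxIdentity B :=
  let ⟨l, hl, hl1⟩ := hB
  ⟨l, hl.neBot, hl.tendsto_mul_right, hl1⟩

variable {B : Type*} [NonUnitalNormedRing B] [NormedSpace ℂ B]

/-- The algebra of bounded left multipliers of `B`: the bounded operators on `B` commuting with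
all right multiplications. -/
def leftMultiplierAlgebra (B : Type*) [NonUnitalNormedRing B] [NormedSpace ℂ B]
    [IsScalarTower ℂ B B] : Subalgebra ℂ (B →L[ℂ] B) where
  carrier := {T | ∀ b c, T (b * c) = T b * c}
  mul_mem' {S T} hS hT b c := by simp only [mul_apply_eq_comp, hT b c, hS (T b) c]
  add_mem' {S T} hS hT b c := by simp only [_root_.add_apply, hS b c, hT b c, add_mul]
  algebraMap_mem' z b c := by simp [Algebra.algebraMap_eq_smul_one, smul_mul_assoc]

variable {E : Type*} [NormedAddCommGroup E] [NormedSpace ℂ E] {L : B →ₙₐ[ℂ] (E →L[ℂ] E)}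

/-- A contractive representation as a bounded linear map. -/
noncomputable def IsContractiveRep.toCLM (hL : IsContractiveRep L) : B →L[ℂ] (E →L[ℂ] E) :=
  (L : B →ₗ[ℂ] (E →L[ℂ] E)).mkContinuous 1 fun b => by simpa using hL b

theorem IsContractiveRep.tendsto_apply (hL : IsContractiveRep L) {ι : Type*} {l : Filter ι}
    {u : ι → B} {b : B} (hu : Tendsto u l (𝓝 b)) (ξ : E) :
    Tendsto (fun i => L (u i) ξ) l (𝓝 (L b ξ)) :=
  ((hL.toCLM.flip ξ).continuous.tendsto b).comp hu

theorem IsContractiveRep.integral_apply (hL : IsContractiveRep L) [CompleteSpace B]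
    [CompleteSpace E] {Y : Type*} [MeasurableSpace Y] {m : Measure Y} {h : Y → B}
    (hh : Integrable h m) (ξ : E) : ∫ t, L (h t) ξ ∂m = L (∫ t, h t ∂m) ξ :=
  (hL.toCLM.flip ξ).integral_comp_comm hh

theorem IsNondegenerateRep.clm_ext (hLn : IsNondegenerateRep L) {F : Type*} [NormedAddCommGroup F]
    [NormedSpace ℂ F] {S T : E →L[ℂ] F} (h : ∀ b ξ, S (L b ξ) = T (L b ξ)) : S = T :=
  ContinuousLinearMap.ext_on hLn (by rintro _ ⟨b, ξ, rfl⟩; exact h b ξ)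

open scoped TensorProduct in
/-- The linear map `b ⊗ ξ ↦ L(b)ξ` of a representation `L`. -/
noncomputable def actionMap (L : B →ₙₐ[ℂ] (E →L[ℂ] E)) : B ⊗[ℂ] E →ₗ[ℂ] E :=
  TensorProduct.lift ((ContinuousLinearMap.coeLM ℂ) ∘ₗ (L : B →ₗ[ℂ] (E →L[ℂ] E)))

@[simp] theorem actionMap_tmul (b : B) (ξ : E) : actionMap L (b ⊗ₜ ξ) = L b ξ := rfl

theorem IsNondegenerateRep.denseRange_actionMap (hLn : IsNondegenerateRep L) :
    DenseRange (actionMap L) := by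
  refine hLn.mono ?_
  rw [← LinearMap.coe_range, SetLike.coe_subset_coe, Submodule.span_le]
  rintro _ ⟨b, ξ, rfl⟩
  exact ⟨b ⊗ₜ ξ, rfl⟩

variable [IsScalarTower ℂ B B]

/-- The action of `T` is the strong limit of the operators `L (T e)` as `e` runs through the
approximate identity. -/
theorem norm_actionMap_rTensor_le (hB : HasContractiveLeftApproxIdentity B)
    (hL : IsContractiveRep L) (T : leftMultiplierAlgebra B) (z : TensorProduct ℂ B E) :
    ‖actionMap L (T.1.toLinearMap.rTensor E z)‖ ≤ ‖T‖ * ‖actionMap L z‖ := by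
  obtain ⟨l, _, hl, hl1⟩ := hB
  have hlim : Tendsto (fun e => L (T.1 e) (actionMap L z)) l
      (𝓝 (actionMap L (T.1.toLinearMap.rTensor E z))) := by
    induction z with
    | zero => simp
    | tmul b ξ =>
      have hTb : Tendsto (fun e => T.1 (e * b)) l (𝓝 (T.1 b)) :=
        (T.1.continuous.tendsto b).comp (hl b)
      simpa [T.2 _ b] using hL.tendsto_apply hTb ξ
    | add y z hy hz => simpa using hy.add hz
  refine le_of_tendsto hlim.norm (hl1.mono fun e he => (L (T.1 e)).le_of_opNorm_le ?_ _)
  exact (hL _).trans (T.1.unit_le_opNorm e he)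

variable [CompleteSpace E]

/-- The operator by which a left multiplier `T` of `B` acts on the space of a representation `L`. It
is meaningful only when `‖actionMap L z‖` bounds the norm of the image of `z` under `T`, and is the
junk value of `LinearMap.extendOfNorm` otherwise. -/
noncomputable def multiplierOperator (L : B →ₙₐ[ℂ] (E →L[ℂ] E)) (T : leftMultiplierAlgebra B) :
    E →L[ℂ] E :=
  (actionMap L ∘ₗ T.1.toLinearMap.rTensor E).extendOfNorm (actionMap L)

section

variable (hB : HasContractiveLeftApproxIdentity B) (hL : IsContractiveRep L)
  (hLn : IsNondegenerateRep L)
include hB hL hLn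

theorem multiplierOperator_apply (T : leftMultiplierAlgebra B) (b : B) (ξ : E) :
    multiplierOperator L T (L b ξ) = L (T.1 b) ξ :=
  LinearMap.extendOfNorm_eq hLn.denseRange_actionMap ⟨_, norm_actionMap_rTensor_le hB hL T⟩
    (b ⊗ₜ ξ)

theorem norm_multiplierOperator_le (T : leftMultiplierAlgebra B) :
    ‖multiplierOperator L T‖ ≤ ‖T‖ :=
  LinearMap.opNorm_extendOfNorm_le hLn.denseRange_actionMap (norm_nonneg T)
    (norm_actionMap_rTensor_le hB hL T)

/-- The extension of a nondegenerate contractive representation `L` of `B` to the algebra of left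
multipliers, determined by `T (L(b)ξ) = L(T b)ξ`. -/
noncomputable def multiplierExtension : leftMultiplierAlgebra B →ₐ[ℂ] (E →L[ℂ] E) :=
  have happly := multiplierOperator_apply hB hL hLn
  AlgHom.ofLinearMap
    { toFun := multiplierOperator L
      map_add' := fun S T => hLn.clm_ext fun b ξ => by simp [happly]
      map_smul' := fun c T => hLn.clm_ext fun b ξ => by simp [happly] }
    (hLn.clm_ext fun b ξ => by simp [happly])
    fun S T => hLn.clm_ext fun b ξ => by simp [happly]

theorem multiplierExtension_apply (T : leftMultiplierAlgebra B) (b : B) (ξ : E) :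
    multiplierExtension hB hL hLn T (L b ξ) = L (T.1 b) ξ :=
  multiplierOperator_apply hB hL hLn T b ξ

theorem norm_multiplierExtension_le (T : leftMultiplierAlgebra B) :
    ‖multiplierExtension hB hL hLn T‖ ≤ ‖T‖ :=
  norm_multiplierOperator_le hB hL hLn T

theorem tendsto_multiplierExtension {ι : Type*} {l : Filter ι} {T : ι → leftMultiplierAlgebra B}
    {S : leftMultiplierAlgebra B} {C : ℝ} (hT : ∀ᶠ i in l, ‖T i‖ ≤ C)
    (h : ∀ b, Tendsto (fun i => (T i).1 b) l (𝓝 (S.1 b))) (ξ : E) :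
    Tendsto (fun i => multiplierExtension hB hL hLn (T i) ξ) l
      (𝓝 (multiplierExtension hB hL hLn S ξ)) := by
  refine tendsto_clm_apply_of_dense_span
    (hT.mono fun i => (norm_multiplierExtension_le hB hL hLn (T i)).trans) hLn ?_ ξ
  rintro _ ⟨b, η, rfl⟩
  simpa only [multiplierExtension_apply] using hL.tendsto_apply (h b) η

end

end LeftMultipliers

section IsometricRep

variable {G E : Type*} [Group G] [NormedAddCommGroup E] [NormedSpace ℂ E]

theorem norm_apply_eq_of_forall_norm_le_one {u : G →* (E →L[ℂ] E)} (hu : ∀ t, ‖u t‖ ≤ 1) (t : G)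
    (ξ : E) : ‖u t ξ‖ = ‖ξ‖ := by
  have hcontr (s : G) (η : E) : ‖u s η‖ ≤ ‖η‖ := by simpa using (u s).le_of_opNorm_le (hu s) η
  refine (hcontr t ξ).antisymm ?_
  simpa [← mul_apply_eq_comp, ← map_mul] using hcontr t⁻¹ (u t ξ)

/-- A representation of a group by contractions, regarded as one by surjective isometries. -/
noncomputable def isometricRep (u : G →* (E →L[ℂ] E)) (hu : ∀ t, ‖u t‖ ≤ 1) :
    G →* (E ≃ₗᵢ[ℂ] E) where
  toFun t := ⟨(ContinuousLinearEquiv.unitsEquiv ℂ E (u.toHomUnits t)).toLinearEquiv,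
    norm_apply_eq_of_forall_norm_le_one hu t⟩
  map_one' := by ext ξ; exact DFunLike.congr_fun (map_one u) ξ
  map_mul' s t := by ext ξ; exact DFunLike.congr_fun (map_mul u s t) ξ

end IsometricRep

section CrossedProductMultipliers

variable {G : Type u} {A : Type v} [Group G] [TopologicalSpace G] [NonUnitalNormedRing A]
  [NormedSpace ℂ A]

variable [MeasurableSpace G] {α : IsometricAction G A} {μ : Measure G}

namespace TwistedCc

@[simp] theorem sub_apply (f g : TwistedCc α μ) (t : G) : (f - g) t = f t - g t := rfl

/-- The function `φ ⊗ a`, that is `t ↦ φ(t) a`. -/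
noncomputable def elementary (φ : C_c(G, ℝ)) (a : A) : TwistedCc α μ :=
  show C_c(G, A) from
  { toFun := fun t => φ t • a
    continuous_toFun := φ.continuous.smul continuous_const
    hasCompactSupport' := φ.hasCompactSupport.smul_right }

@[simp] theorem elementary_apply (φ : C_c(G, ℝ)) (a : A) (t : G) :
    (elementary φ a : TwistedCc α μ) t = φ t • a := rfl

end TwistedCc

variable [IsTopologicalGroup G] [BorelSpace G] [LocallyCompactSpace G] [IsScalarTower ℂ A A]
  [SMulCommClass ℂ A A] [CompleteSpace A]

namespace TwistedCc

/-- Pointwise left multiplication by an element of the coefficient algebra. -/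
def leftMul (a : A) : TwistedCc α μ →ₗ[ℂ] TwistedCc α μ where
  toFun f :=
    { toFun := fun t => a * f t
      continuous_toFun := continuous_const.mul f.continuous
      hasCompactSupport' := f.hasCompactSupport.mul_left (f := fun _ => a) }
  map_add' f g := by ext t; exact mul_add a (f t) (g t)
  map_smul' c f := by ext t; exact mul_smul_comm c a (f t)

@[simp] theorem leftMul_apply (a : A) (f : TwistedCc α μ) (t : G) :
    leftMul a f t = a * f t := rfl

/-- The twisted left translation `(t · f)(s) = α_t(f(t⁻¹s))`. -/
def translate (t : G) : TwistedCc α μ →ₗ[ℂ] TwistedCc α μ where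
  toFun f :=
    { toFun := fun s => α.aut t (f (t⁻¹ * s))
      continuous_toFun := (α.aut t).continuous.comp (f.continuous.comp (continuous_const_mul t⁻¹))
      hasCompactSupport' := (f.hasCompactSupport.comp_homeomorph (Homeomorph.mulLeft t⁻¹)).comp_left
        (map_zero (α.aut t)) }
  map_add' f g := by ext s; exact map_add (α.aut t) (f (t⁻¹ * s)) (g (t⁻¹ * s))
  map_smul' c f := by ext s; exact map_smul (α.aut t) c (f (t⁻¹ * s))

@[simp] theorem translate_apply (t : G) (f : TwistedCc α μ) (s : G) :
    translate t f s = α.aut t (f (t⁻¹ * s)) := rfl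

end TwistedCc

variable [IsFiniteMeasureOnCompacts μ] {p : ℝ≥0∞} [Fact (1 ≤ p)]

namespace CovariantRep

variable {X : Type*} [MeasurableSpace X] {ν : Measure X}

theorem integrated_leftMul (R : CovariantRep p α ν) (a : A) (f : TwistedCc α μ) :
    R.integrated (f.leftMul a) = R.π a * R.integrated f := by
  ext1 ξ
  rw [mul_apply_eq_comp, integrated_apply, integrated_apply,
    ← (R.π a).integral_comp_comm (R.integrable_integrand f ξ)]
  simp only [TwistedCc.leftMul_apply, map_mul, mul_apply_eq_comp]

theorem integrated_translate [μ.IsMulLeftInvariant] (R : CovariantRep p α ν) (t : G)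
    (f : TwistedCc α μ) (ξ : Lp ℂ p ν) :
    R.integrated (f.translate t) ξ = R.v t (R.integrated f ξ) := by
  have hcov (s : G) :
      R.π (f.translate t (t * s)) (R.v (t * s) ξ) = R.v t (R.π (f s) (R.v s ξ)) := by
    rw [TwistedCc.translate_apply, inv_mul_cancel_left, ← R.covariant, map_mul]
    simp
  calc R.integrated (f.translate t) ξ
      = ∫ s, R.v t (R.π (f s) (R.v s ξ)) ∂μ := by
        rw [integrated_apply, ← integral_mul_left_eq_self _ t]
        simp only [hcov]
    _ = R.v t (R.integrated f ξ) := (R.v t).toLinearIsometry.integral_comp_comm _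

end CovariantRep

namespace FpCrossedProduct

variable [μ.IsMulLeftInvariant]

theorem norm_le_of_forall_norm_integratedForm_le {y : FpCrossedProduct.{w} p α μ} {c : ℝ}
    (hc : 0 ≤ c) (h : ∀ (X : Type w) [MeasurableSpace X] (ν : Measure X) [SigmaFinite ν]
      (R : CovariantRep p α ν), ‖R.integratedForm μ y‖ ≤ c) : ‖y‖ ≤ c := by
  refine le_of_forall_pos_le_add fun ε hε => ?_
  obtain ⟨f, hf⟩ := Metric.denseRange_iff.1 denseRange_ofCc y (ε / 2) (half_pos hε)
  rw [dist_eq_norm] at hf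
  have hf_norm : ‖ofCc.{w} p α μ f‖ ≤ c + ε / 2 := by
    rw [norm_ofCc]
    refine fpNorm_le f (by positivity) fun X _ ν _ R => ?_
    have hR : ‖R.integratedForm μ (y - ofCc p α μ f)‖ ≤ ε / 2 :=
      (R.norm_integratedForm_le _).trans hf.le
    rw [map_sub, R.integratedForm_ofCc, norm_sub_rev] at hR
    exact (norm_le_norm_add_norm_sub' _ _).trans (add_le_add (h X ν R) hR)
  linarith [norm_le_norm_add_norm_sub' y (ofCc p α μ f)]

theorem ext_integratedForm {y z : FpCrossedProduct.{w} p α μ}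
    (h : ∀ (X : Type w) [MeasurableSpace X] (ν : Measure X) [SigmaFinite ν]
      (R : CovariantRep p α ν), R.integratedForm μ y = R.integratedForm μ z) : y = z := by
  refine sub_eq_zero.1 (norm_le_zero_iff.1 ?_)
  refine norm_le_of_forall_norm_integratedForm_le le_rfl fun X _ ν _ R => ?_
  rw [map_sub, h X ν R, sub_self, norm_zero]

theorem leftMultiplier_ext_integratedForm
    {S T : leftMultiplierAlgebra (FpCrossedProduct.{w} p α μ)}
    (h : ∀ (X : Type w) [MeasurableSpace X] (ν : Measure X) [SigmaFinite ν]
      (R : CovariantRep p α ν) (y : FpCrossedProduct.{w} p α μ) (ξ : Lp ℂ p ν),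
      R.integratedForm μ (S.1 y) ξ = R.integratedForm μ (T.1 y) ξ) : S = T :=
  Subtype.ext <| ContinuousLinearMap.ext fun y => ext_integratedForm fun X _ ν _ R =>
    ContinuousLinearMap.ext fun ξ => h X ν R y ξ

theorem norm_ofCc_leftMul_le (a : A) (f : TwistedCc α μ) :
    ‖ofCc.{w} p α μ (f.leftMul a)‖ ≤ ‖a‖ * ‖ofCc.{w} p α μ f‖ := by
  rw [norm_ofCc, norm_ofCc]
  refine fpNorm_le _ (mul_nonneg (norm_nonneg a) (fpNorm_nonneg f)) fun X _ ν _ R => ?_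
  rw [R.integrated_leftMul]
  exact norm_mul_le_of_le (R.contractive a) (norm_integrated_le_fpNorm R f)

theorem norm_ofCc_translate_le (t : G) (f : TwistedCc α μ) :
    ‖ofCc.{w} p α μ (f.translate t)‖ ≤ ‖ofCc.{w} p α μ f‖ := by
  rw [norm_ofCc, norm_ofCc]
  refine fpNorm_le _ (fpNorm_nonneg f) fun X _ ν _ R =>
    ContinuousLinearMap.opNorm_le_bound _ (fpNorm_nonneg f) fun ξ => ?_
  rw [R.integrated_translate, LinearIsometryEquiv.norm_map]
  exact (R.integrated f).le_of_opNorm_le (norm_integrated_le_fpNorm R f) ξ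

/-- The extension by continuity to `F^p(G, A, α)` of a linear operator on `C_c(G, A, α)`. It is the
junk value of `LinearMap.extendOfNorm` when the operator is not bounded for the norm `fpNorm`. -/
noncomputable def extendOperator (T : TwistedCc α μ →ₗ[ℂ] TwistedCc α μ) :
    FpCrossedProduct.{w} p α μ →L[ℂ] FpCrossedProduct.{w} p α μ :=
  ((ofCc p α μ : TwistedCc α μ →ₗ[ℂ] FpCrossedProduct.{w} p α μ) ∘ₗ T).extendOfNorm
    (ofCc p α μ : TwistedCc α μ →ₗ[ℂ] FpCrossedProduct.{w} p α μ)

variable {T : TwistedCc α μ →ₗ[ℂ] TwistedCc α μ} {C : ℝ}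

theorem extendOperator_ofCc
    (hT : ∀ f, ‖ofCc.{w} p α μ (T f)‖ ≤ C * ‖ofCc.{w} p α μ f‖) (f : TwistedCc α μ) :
    extendOperator T (ofCc.{w} p α μ f) = ofCc p α μ (T f) :=
  LinearMap.extendOfNorm_eq denseRange_ofCc ⟨C, hT⟩ f

theorem norm_extendOperator_le (hC : 0 ≤ C)
    (hT : ∀ f, ‖ofCc.{w} p α μ (T f)‖ ≤ C * ‖ofCc.{w} p α μ f‖) :
    ‖(extendOperator T : FpCrossedProduct.{w} p α μ →L[ℂ] _)‖ ≤ C :=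
  LinearMap.opNorm_extendOfNorm_le denseRange_ofCc hC hT

theorem extendOperator_leftMul_ofCc (a : A) (f : TwistedCc α μ) :
    extendOperator (TwistedCc.leftMul a) (ofCc.{w} p α μ f) = ofCc p α μ (f.leftMul a) :=
  extendOperator_ofCc (norm_ofCc_leftMul_le a) f

theorem extendOperator_translate_ofCc (t : G) (f : TwistedCc α μ) :
    extendOperator (TwistedCc.translate t) (ofCc.{w} p α μ f) = ofCc p α μ (f.translate t) :=
  extendOperator_ofCc (C := 1) (by simpa using norm_ofCc_translate_le t) f

variable {X : Type w} [MeasurableSpace X] {ν : Measure X} [SigmaFinite ν]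

theorem integratedForm_extendOperator_leftMul (R : CovariantRep p α ν) (a : A)
    (y : FpCrossedProduct.{w} p α μ) :
    R.integratedForm μ (extendOperator (TwistedCc.leftMul a) y) =
      R.π a * R.integratedForm μ y := by
  refine denseRange_ofCc.induction_on y (isClosed_eq ?_ ?_) fun f => ?_
  · exact R.continuous_integratedForm.comp (ContinuousLinearMap.continuous _)
  · exact continuous_const.mul R.continuous_integratedForm
  · rw [extendOperator_leftMul_ofCc, R.integratedForm_ofCc, R.integratedForm_ofCc,
      R.integrated_leftMul]

theorem integratedForm_extendOperator_translate (R : CovariantRep p α ν) (t : G)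
    (y : FpCrossedProduct.{w} p α μ) (ξ : Lp ℂ p ν) :
    R.integratedForm μ (extendOperator (TwistedCc.translate t) y) ξ =
      R.v t (R.integratedForm μ y ξ) := by
  have hcont := (R.continuous_integratedForm (μ := μ)).clm_apply (continuous_const (y := ξ))
  refine denseRange_ofCc.induction_on y (isClosed_eq ?_ ?_) fun f => ?_
  · exact hcont.comp (ContinuousLinearMap.continuous _)
  · exact (R.v t).continuous.comp hcont
  · rw [extendOperator_translate_ofCc, R.integratedForm_ofCc, R.integratedForm_ofCc,
      R.integrated_translate]

/-- The canonical homomorphism from `A` to the left multipliers of `F^p(G, A, α)`, extending the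
pointwise multiplications. -/
noncomputable def coeffMultiplier (p : ℝ≥0∞) [Fact (1 ≤ p)] (α : IsometricAction G A)
    (μ : Measure G) [IsFiniteMeasureOnCompacts μ] [μ.IsMulLeftInvariant] :
    A →ₙₐ[ℂ] leftMultiplierAlgebra (FpCrossedProduct.{w} p α μ) where
  toFun a := ⟨extendOperator (TwistedCc.leftMul a), fun y z =>
    ext_integratedForm fun X _ ν _ R => by
      simp only [integratedForm_extendOperator_leftMul, map_mul, mul_assoc]⟩
  map_smul' c a := leftMultiplier_ext_integratedForm fun X _ ν _ R y ξ => by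
      simp [integratedForm_extendOperator_leftMul]
  map_zero' := leftMultiplier_ext_integratedForm fun X _ ν _ R y ξ => by
      simp [integratedForm_extendOperator_leftMul]
  map_add' a b := leftMultiplier_ext_integratedForm fun X _ ν _ R y ξ => by
      simp [integratedForm_extendOperator_leftMul, add_mul]
  map_mul' a b := leftMultiplier_ext_integratedForm fun X _ ν _ R y ξ => by
      simp [integratedForm_extendOperator_leftMul, mul_assoc]

/-- The canonical homomorphism from `G` to the left multipliers of `F^p(G, A, α)`, extending the
twisted translations. -/
noncomputable def groupMultiplier (p : ℝ≥0∞) [Fact (1 ≤ p)] (α : IsometricAction G A)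
    (μ : Measure G) [IsFiniteMeasureOnCompacts μ] [μ.IsMulLeftInvariant] :
    G →* leftMultiplierAlgebra (FpCrossedProduct.{w} p α μ) where
  toFun t := ⟨extendOperator (TwistedCc.translate t), fun y z =>
    ext_integratedForm fun X _ ν _ R => ContinuousLinearMap.ext fun ξ => by
      simp only [integratedForm_extendOperator_translate, map_mul, mul_apply_eq_comp]⟩
  map_one' := leftMultiplier_ext_integratedForm fun X _ ν _ R y ξ => by
      simp [integratedForm_extendOperator_translate]
  map_mul' s t := leftMultiplier_ext_integratedForm fun X _ ν _ R y ξ => by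
      simp [integratedForm_extendOperator_translate]

theorem integratedForm_coeffMultiplier (R : CovariantRep p α ν) (a : A)
    (y : FpCrossedProduct.{w} p α μ) :
    R.integratedForm μ ((coeffMultiplier p α μ a).1 y) = R.π a * R.integratedForm μ y :=
  integratedForm_extendOperator_leftMul R a y

theorem integratedForm_groupMultiplier (R : CovariantRep p α ν) (t : G)
    (y : FpCrossedProduct.{w} p α μ) (ξ : Lp ℂ p ν) :
    R.integratedForm μ ((groupMultiplier p α μ t).1 y) ξ = R.v t (R.integratedForm μ y ξ) :=
  integratedForm_extendOperator_translate R t y ξ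

theorem coeffMultiplier_ofCc (a : A) (f : TwistedCc α μ) :
    (coeffMultiplier.{w} p α μ a).1 (ofCc p α μ f) = ofCc p α μ (f.leftMul a) :=
  extendOperator_leftMul_ofCc a f

theorem groupMultiplier_ofCc (t : G) (f : TwistedCc α μ) :
    (groupMultiplier.{w} p α μ t).1 (ofCc p α μ f) = ofCc p α μ (f.translate t) :=
  extendOperator_translate_ofCc t f

theorem norm_coeffMultiplier_le (a : A) : ‖coeffMultiplier.{w} p α μ a‖ ≤ ‖a‖ :=
  norm_extendOperator_le (norm_nonneg a) (norm_ofCc_leftMul_le a)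

theorem norm_groupMultiplier_le (t : G) : ‖groupMultiplier.{w} p α μ t‖ ≤ 1 :=
  norm_extendOperator_le zero_le_one (by simpa using norm_ofCc_translate_le t)

theorem groupMultiplier_conj_coeffMultiplier (t : G) (a : A) :
    groupMultiplier.{w} p α μ t * coeffMultiplier p α μ a * groupMultiplier p α μ t⁻¹ =
      coeffMultiplier p α μ (α.aut t a) := by
  refine leftMultiplier_ext_integratedForm fun X _ ν _ R y ξ => ?_
  simpa [integratedForm_coeffMultiplier, integratedForm_groupMultiplier] using
    R.covariant t a (R.integratedForm μ y ξ)

end FpCrossedProduct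

end CrossedProductMultipliers

section StrongContinuity

variable {G : Type u} {A : Type v} [Group G] [TopologicalSpace G] [IsTopologicalGroup G]
  [LocallyCompactSpace G] [MeasurableSpace G] [BorelSpace G]
  [NonUnitalNormedRing A] [NormedSpace ℂ A] [IsScalarTower ℂ A A] [SMulCommClass ℂ A A]
  [CompleteSpace A] {α : IsometricAction G A} {μ : Measure G} [IsFiniteMeasureOnCompacts μ]
  [μ.IsMulLeftInvariant] {p : ℝ≥0∞} [Fact (1 ≤ p)]

namespace FpCrossedProduct

theorem norm_ofCc_le_integral (f : TwistedCc α μ) : ‖ofCc.{w} p α μ f‖ ≤ ∫ t, ‖f t‖ ∂μ := by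
  rw [norm_ofCc]
  exact fpNorm_le f (integral_nonneg fun _ => norm_nonneg _) fun X _ ν _ R =>
    R.norm_integrated_le f

theorem norm_ofCc_le_of_support_subset {f : TwistedCc α μ} {K : Set G} {C : ℝ} (hK : IsCompact K)
    (hf : ∀ t ∉ K, f t = 0) (hC : ∀ t ∈ K, ‖f t‖ ≤ C) : ‖ofCc.{w} p α μ f‖ ≤ C * μ.real K := by
  have h_integral : ∫ t in K, ‖f t‖ ∂μ = ∫ t, ‖f t‖ ∂μ :=
    setIntegral_eq_integral_of_forall_compl_eq_zero fun t ht => by rw [hf t ht, norm_zero]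
  calc ‖ofCc.{w} p α μ f‖ ≤ ∫ t in K, ‖f t‖ ∂μ := h_integral ▸ norm_ofCc_le_integral f
    _ ≤ C * μ.real K := (le_abs_self _).trans <|
      norm_setIntegral_le_of_norm_le_const (f := fun t => ‖f t‖) hK.measure_lt_top
        fun t ht => by simpa using hC t ht

theorem tendsto_ofCc {ι : Type*} {l : Filter ι} {H : ι → TwistedCc α μ} {f : TwistedCc α μ}
    {K : Set G} (hK : IsCompact K) (hf : ∀ t ∉ K, f t = 0)
    (hH : ∀ᶠ i in l, ∀ t ∉ K, H i t = 0)
    (h : ∀ t ∈ K, Tendsto (fun q : ι × G => H q.1 q.2) (l ×ˢ 𝓝 t) (𝓝 (f t))) :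
    Tendsto (fun i => ofCc.{w} p α μ (H i)) l (𝓝 (ofCc p α μ f)) := by
  rw [Metric.tendsto_nhds]
  intro ε hε
  obtain ⟨δ, hδ, hδε⟩ := exists_pos_mul_lt hε (μ.real K)
  have hunif := Metric.tendstoUniformlyOn_iff.1
    (tendstoUniformlyOn_of_forall_tendsto_nhds (H := fun i t => H i t) hK f.continuous h) δ hδ
  filter_upwards [hH, hunif] with i hHi hi
  rw [dist_eq_norm, ← map_sub]
  refine (norm_ofCc_le_of_support_subset hK (fun t ht => ?_) fun t ht => ?_).trans_lt
    (mul_comm δ _ ▸ hδε)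
  · simp [hHi t ht, hf t ht]
  · rw [TwistedCc.sub_apply, ← dist_eq_norm, dist_comm]
    exact (hi t ht).le

theorem dense_span_range_ofCc :
    Dense (Submodule.span ℂ (Set.range (ofCc.{w} p α μ)) : Set (FpCrossedProduct.{w} p α μ)) :=
  denseRange_ofCc.mono Submodule.subset_span

theorem continuous_groupMultiplier (y : FpCrossedProduct.{w} p α μ) :
    Continuous fun t => (groupMultiplier p α μ t).1 y := by
  refine continuous_iff_continuousAt.2 fun s => tendsto_clm_apply_of_dense_span
    (T := fun t => (groupMultiplier p α μ t).1) (Eventually.of_forall norm_groupMultiplier_le)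
    dense_span_range_ofCc ?_ y
  rintro _ ⟨f, rfl⟩
  obtain ⟨V, hV, hVs⟩ := exists_compact_mem_nhds s
  have hsupp : ∀ t ∈ V, ∀ r ∉ V * tsupport f, f.translate t r = 0 := fun t ht r hr => by
    rw [TwistedCc.translate_apply, f.eq_zero_of_notMem fun h => hr ⟨t, ht, _, h, by simp⟩, map_zero]
  simp only [groupMultiplier_ofCc]
  refine tendsto_ofCc (hV.mul f.hasCompactSupport) (hsupp s (mem_of_mem_nhds hVs))
    (by filter_upwards [hVs] using hsupp) fun r _ => ?_
  rw [← nhds_prod_eq]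
  exact (f.continuous_twist continuous_fst (by fun_prop)).tendsto (s, r)

theorem tendsto_coeffMultiplier {l : Filter A} (hl : ∀ b, Tendsto (· * b) l (𝓝 b))
    (hl1 : ∀ᶠ e in l, ‖e‖ ≤ 1) (y : FpCrossedProduct.{w} p α μ) :
    Tendsto (fun e => (coeffMultiplier p α μ e).1 y) l (𝓝 y) := by
  refine tendsto_clm_apply_of_dense_span (T := fun e => (coeffMultiplier p α μ e).1)
    (S := ContinuousLinearMap.id ℂ _)
    (hl1.mono fun e he => (norm_coeffMultiplier_le e).trans he) dense_span_range_ofCc ?_ y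
  rintro _ ⟨f, rfl⟩
  simp only [coeffMultiplier_ofCc]
  refine tendsto_ofCc f.hasCompactSupport (fun t => f.eq_zero_of_notMem)
    (Eventually.of_forall fun e t ht => by simp [f.eq_zero_of_notMem ht]) fun t _ => ?_
  have hmul : ∀ᶠ q : A × G in l ×ˢ 𝓝 t, ‖ContinuousLinearMap.mul ℂ A q.1‖ ≤ 1 :=
    tendsto_fst.eventually
      (hl1.mono fun e he => (ContinuousLinearMap.opNorm_mul_apply_le ℂ A e).trans he)
  exact tendsto_clm_apply_of_eventually_norm_le hmul ((f.continuous.tendsto t).comp tendsto_snd)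
    ((hl (f t)).comp tendsto_fst)

theorem continuous_coeffMultiplier_groupMultiplier (f : TwistedCc α μ)
    (y : FpCrossedProduct.{w} p α μ) :
    Continuous fun t => (coeffMultiplier p α μ (f t)).1 ((groupMultiplier p α μ t).1 y) := by
  have hcoeff : Continuous (coeffMultiplier.{w} p α μ) :=
    AddMonoidHomClass.continuous_of_bound _ 1 fun a => by
      rw [one_mul]
      exact norm_coeffMultiplier_le a
  exact (continuous_subtype_val.comp (hcoeff.comp f.continuous)).clm_apply
    (continuous_groupMultiplier y)

theorem integrable_coeffMultiplier_groupMultiplier (f : TwistedCc α μ)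
    (y : FpCrossedProduct.{w} p α μ) :
    Integrable (fun t => (coeffMultiplier p α μ (f t)).1 ((groupMultiplier p α μ t).1 y)) μ :=
  f.integrable_of_factor (continuous_coeffMultiplier_groupMultiplier f y) fun t ht => by simp [ht]

theorem integral_coeffMultiplier_groupMultiplier (f : TwistedCc α μ)
    (y : FpCrossedProduct.{w} p α μ) :
    ∫ t, (coeffMultiplier p α μ (f t)).1 ((groupMultiplier p α μ t).1 y) ∂μ = ofCc p α μ f * y := by
  refine ext_integratedForm fun X _ ν _ R => ContinuousLinearMap.ext fun ξ => ?_
  have hR : IsContractiveRep (R.integratedForm μ) := R.norm_integratedForm_le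
  rw [← hR.integral_apply (integrable_coeffMultiplier_groupMultiplier f y)]
  simp only [integratedForm_coeffMultiplier, integratedForm_groupMultiplier, mul_apply_eq_comp,
    map_mul, R.integratedForm_ofCc]
  exact (R.integrated_apply f _).symm

end FpCrossedProduct

end StrongContinuity

section ApproximateDelta

variable {G : Type*} [TopologicalSpace G] [MeasurableSpace G]

/-- The probability densities with respect to `μ` that are continuous with compact support and
vanish off `U`. -/
def bumpDensities (μ : Measure G) (U : Set G) : Set C_c(G, ℝ) :=
  {φ | (∀ t, 0 ≤ φ t) ∧ ∫ t, φ t ∂μ = 1 ∧ ∀ t ∉ U, φ t = 0}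

/-- The filter along which bump densities concentrate at `x`, so that the measures `φ μ` approximate
the Dirac measure at `x`. -/
def approxDelta (μ : Measure G) (x : G) : Filter C_c(G, ℝ) :=
  (𝓝 x).lift' (bumpDensities μ)

theorem bumpDensities_mono (μ : Measure G) : Monotone (bumpDensities μ) :=
  fun _ _ hUV _ hφ => ⟨hφ.1, hφ.2.1, fun t ht => hφ.2.2 t fun h => ht (hUV h)⟩

theorem eventually_mem_bumpDensities (μ : Measure G) {x : G} {U : Set G} (hU : U ∈ 𝓝 x) :
    ∀ᶠ φ in approxDelta μ x, φ ∈ bumpDensities μ U :=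
  mem_lift' hU

theorem bumpDensities_nonempty [R1Space G] [LocallyCompactSpace G] [OpensMeasurableSpace G]
    (μ : Measure G) [IsFiniteMeasureOnCompacts μ] [μ.IsOpenPosMeasure] {x : G} {U : Set G}
    (hU : U ∈ 𝓝 x) : (bumpDensities μ U).Nonempty := by
  obtain ⟨f, hf1, hf0, hfc, hf⟩ := exists_continuous_one_zero_of_isCompact
    (isCompact_singleton (x := x)).closure (isOpen_interior (s := U)).isClosed_compl <|
    Set.disjoint_compl_right_iff_subset.2 <| isCompact_singleton.closure_subset_of_isOpen
      isOpen_interior (Set.singleton_subset_iff.2 (mem_interior_iff_mem_nhds.2 hU))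
  have hpos : 0 < ∫ t, f t ∂μ :=
    f.continuous.integral_pos_of_hasCompactSupport_nonneg_nonzero hfc (fun t => (hf t).1) (x := x)
      (by simp [hf1 (subset_closure rfl)])
  refine ⟨(∫ t, f t ∂μ)⁻¹ • (⟨f, hfc⟩ : C_c(G, ℝ)), fun t => ?_, ?_, fun t ht => ?_⟩
  · exact mul_nonneg (inv_nonneg.2 hpos.le) (hf t).1
  · exact (integral_const_mul _ _).trans (inv_mul_cancel₀ hpos.ne')
  · exact mul_eq_zero_of_right _ (hf0 fun h => ht (interior_subset h))

instance [R1Space G] [LocallyCompactSpace G] [OpensMeasurableSpace G] (μ : Measure G)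
    [IsFiniteMeasureOnCompacts μ] [μ.IsOpenPosMeasure] (x : G) : (approxDelta μ x).NeBot :=
  (lift'_neBot_iff (bumpDensities_mono μ)).2 fun _ => bumpDensities_nonempty μ

theorem tendsto_integral_smul_approxDelta [OpensMeasurableSpace G] {μ : Measure G}
    [IsFiniteMeasureOnCompacts μ] {F : Type*} [NormedAddCommGroup F] [NormedSpace ℝ F]
    [CompleteSpace F] {h : G → F} (hh : Continuous h) (x : G) :
    Tendsto (fun φ : C_c(G, ℝ) => ∫ t, φ t • h t ∂μ) (approxDelta μ x) (𝓝 (h x)) := by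
  refine Metric.nhds_basis_closedBall.tendsto_right_iff.2 fun ε hε => ?_
  have hU : {t | ‖h t - h x‖ ≤ ε} ∈ 𝓝 x := by
    filter_upwards [hh.tendsto x (Metric.closedBall_mem_nhds _ hε)] with t ht
    exact mem_closedBall_iff_norm.1 ht
  filter_upwards [eventually_mem_bumpDensities μ hU] with φ hφ
  obtain ⟨hφ_nonneg, hφ_integral, hφ_zero⟩ := hφ
  have hφ_int : Integrable φ μ := φ.continuous.integrable_of_hasCompactSupport φ.hasCompactSupport
  have hφh_int : Integrable (fun t => φ t • h t) μ :=
    (φ.continuous.smul hh).integrable_of_hasCompactSupport φ.hasCompactSupport.smul_right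
  have hbound (t : G) : ‖φ t • h t - φ t • h x‖ ≤ φ t * ε := by
    rw [← smul_sub, norm_smul, Real.norm_of_nonneg (hφ_nonneg t)]
    by_cases ht : ‖h t - h x‖ ≤ ε
    · exact mul_le_mul_of_nonneg_left ht (hφ_nonneg t)
    · simp [hφ_zero t ht]
  have hdiff : ∫ t, φ t • h t ∂μ - h x = ∫ t, (φ t • h t - φ t • h x) ∂μ := by
    rw [integral_sub hφh_int (hφ_int.smul_const _), integral_smul_const, hφ_integral, one_smul]
  rw [mem_closedBall_iff_norm, hdiff]
  calc ‖∫ t, (φ t • h t - φ t • h x) ∂μ‖ ≤ ∫ t, φ t * ε ∂μ :=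
        norm_integral_le_of_norm_le (hφ_int.mul_const ε) (Eventually.of_forall hbound)
    _ = ε := by rw [integral_mul_const, hφ_integral, one_mul]

end ApproximateDelta

section ApproximateIdentity

variable {G : Type u} {A : Type v} [Group G] [TopologicalSpace G] [IsTopologicalGroup G]
  [LocallyCompactSpace G] [MeasurableSpace G] [BorelSpace G]
  [NonUnitalNormedRing A] [NormedSpace ℂ A] [IsScalarTower ℂ A A] [SMulCommClass ℂ A A]
  [CompleteSpace A] {α : IsometricAction G A} {μ : Measure G} {p : ℝ≥0∞} [Fact (1 ≤ p)]

namespace FpCrossedProduct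

theorem ofCc_elementary_mul [IsFiniteMeasureOnCompacts μ] [μ.IsMulLeftInvariant] (φ : C_c(G, ℝ))
    (a : A) (y : FpCrossedProduct.{w} p α μ) :
    ofCc p α μ (.elementary φ a) * y =
      (coeffMultiplier p α μ a).1 (∫ t, φ t • (groupMultiplier p α μ t).1 y ∂μ) := by
  have hφy : Integrable (fun t => φ t • (groupMultiplier p α μ t).1 y) μ :=
    (φ.continuous.smul (continuous_groupMultiplier y)).integrable_of_hasCompactSupport
      φ.hasCompactSupport.smul_right
  rw [← integral_coeffMultiplier_groupMultiplier, ← ContinuousLinearMap.integral_comp_comm _ hφy]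
  refine integral_congr_ae (Eventually.of_forall fun t => ?_)
  simp only [TwistedCc.elementary_apply, ← Complex.coe_smul, map_smul]
  rfl

theorem norm_ofCc_elementary_le [IsFiniteMeasureOnCompacts μ] [μ.IsMulLeftInvariant]
    {φ : C_c(G, ℝ)} {U : Set G} (hφ : φ ∈ bumpDensities μ U) (a : A) :
    ‖ofCc.{w} p α μ (.elementary φ a)‖ ≤ ‖a‖ := by
  refine (norm_ofCc_le_integral _).trans_eq ?_
  simp only [TwistedCc.elementary_apply, norm_smul, Real.norm_of_nonneg (hφ.1 _),
    integral_mul_const, hφ.2.1, one_mul]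

theorem hasContractiveLeftApproxIdentity [μ.IsHaarMeasure]
    (hA : HasContractiveLeftApproxIdentity A) :
    HasContractiveLeftApproxIdentity (FpCrossedProduct.{w} p α μ) := by
  obtain ⟨l, _, hl, hl1⟩ := hA
  refine ⟨(l ×ˢ approxDelta μ 1).map fun q => ofCc p α μ (.elementary q.2 q.1), inferInstance,
    fun y => tendsto_map'_iff.2 ?_, eventually_map.2 ?_⟩
  · have haverage : Tendsto (fun φ : C_c(G, ℝ) => ∫ t, φ t • (groupMultiplier p α μ t).1 y ∂μ)
        (approxDelta μ 1) (𝓝 y) := by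
      simpa using tendsto_integral_smul_approxDelta (continuous_groupMultiplier y) 1
    simp only [Function.comp_def, ofCc_elementary_mul]
    exact tendsto_clm_apply_of_eventually_norm_le
      (T := fun q : A × C_c(G, ℝ) => (coeffMultiplier p α μ q.1).1)
      (tendsto_fst.eventually (hl1.mono fun e he => (norm_coeffMultiplier_le e).trans he))
      (haverage.comp tendsto_snd) ((tendsto_coeffMultiplier hl hl1 y).comp tendsto_fst)
  · filter_upwards [tendsto_fst.eventually hl1,
      tendsto_snd.eventually (eventually_mem_bumpDensities μ univ_mem)] with q he hφ
    exact (norm_ofCc_elementary_le hφ q.1).trans he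

end FpCrossedProduct

end ApproximateIdentity

section Disintegration

variable {G : Type u} {A : Type v} [Group G] [TopologicalSpace G] [IsTopologicalGroup G]
  [LocallyCompactSpace G] [MeasurableSpace G] [BorelSpace G]
  [NonUnitalNormedRing A] [NormedSpace ℂ A] [IsScalarTower ℂ A A] [SMulCommClass ℂ A A]
  [CompleteSpace A] {α : IsometricAction G A} {μ : Measure G} [IsFiniteMeasureOnCompacts μ]
  [μ.IsMulLeftInvariant] {p : ℝ≥0∞} [Fact (1 ≤ p)]

namespace FpCrossedProduct

section

variable {E : Type*} [NormedAddCommGroup E] [NormedSpace ℂ E] [CompleteSpace E]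
  {L : FpCrossedProduct.{w} p α μ →ₙₐ[ℂ] (E →L[ℂ] E)}
  (hB : HasContractiveLeftApproxIdentity (FpCrossedProduct.{w} p α μ)) (hL : IsContractiveRep L)
  (hLn : IsNondegenerateRep L)

/-- The representation of the coefficient algebra underlying a representation of the crossed
product. -/
noncomputable def coeffRep : A →ₙₐ[ℂ] (E →L[ℂ] E) :=
  ((multiplierExtension hB hL hLn : leftMultiplierAlgebra _ →ₐ[ℂ] (E →L[ℂ] E)) :
    leftMultiplierAlgebra _ →ₙₐ[ℂ] (E →L[ℂ] E)).comp (coeffMultiplier p α μ)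

theorem isContractiveRep_coeffRep : IsContractiveRep (coeffRep hB hL hLn) := fun a =>
  (norm_multiplierExtension_le hB hL hLn _).trans (norm_coeffMultiplier_le a)

theorem isNondegenerateRep_coeffRep (hA : HasContractiveLeftApproxIdentity A) :
    IsNondegenerateRep (coeffRep hB hL hLn) := by
  obtain ⟨l, _, hl, hl1⟩ := hA
  refine fun ξ => mem_closure_of_tendsto (f := fun e => coeffRep hB hL hLn e ξ) (b := l) ?_
    (Eventually.of_forall fun e => Submodule.subset_span ⟨e, ξ, rfl⟩)
  have h := tendsto_multiplierExtension (S := 1) hB hL hLn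
    (hl1.mono fun e he => (norm_coeffMultiplier_le e).trans he) (tendsto_coeffMultiplier hl hl1) ξ
  rwa [map_one] at h

theorem norm_multiplierExtension_groupMultiplier_le (t : G) :
    ‖multiplierExtension hB hL hLn (groupMultiplier p α μ t)‖ ≤ 1 :=
  (norm_multiplierExtension_le hB hL hLn _).trans (norm_groupMultiplier_le t)

/-- The isometric representation of the group underlying a representation of the crossed
product. -/
noncomputable def groupRep : G →* (E ≃ₗᵢ[ℂ] E) :=
  isometricRep ((multiplierExtension hB hL hLn).toMonoidHom'.comp (groupMultiplier p α μ))
    (norm_multiplierExtension_groupMultiplier_le hB hL hLn)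

theorem continuous_groupRep (ξ : E) : Continuous fun t => groupRep hB hL hLn t ξ :=
  continuous_iff_continuousAt.2 fun s =>
    tendsto_multiplierExtension (S := groupMultiplier p α μ s) hB hL hLn
      (Eventually.of_forall norm_groupMultiplier_le)
      (fun y => (continuous_groupMultiplier y).tendsto s) ξ

theorem groupRep_coeffRep_groupRep_inv (t : G) (a : A) (ξ : E) :
    groupRep hB hL hLn t (coeffRep hB hL hLn a (groupRep hB hL hLn t⁻¹ ξ)) =
      coeffRep hB hL hLn (α.aut t a) ξ := by
  have h := congrArg (multiplierExtension hB hL hLn · ξ) (groupMultiplier_conj_coeffMultiplier t a)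
  rwa [map_mul, map_mul] at h

theorem coeffRep_groupRep_apply (a : A) (t : G) (y : FpCrossedProduct.{w} p α μ) (ξ : E) :
    coeffRep hB hL hLn a (groupRep hB hL hLn t (L y ξ)) =
      L ((coeffMultiplier p α μ a).1 ((groupMultiplier p α μ t).1 y)) ξ := by
  have ht : groupRep hB hL hLn t (L y ξ) = L ((groupMultiplier p α μ t).1 y) ξ :=
    multiplierExtension_apply hB hL hLn _ y ξ
  rw [ht]
  exact multiplierExtension_apply hB hL hLn _ _ ξ

end

variable {X : Type*} [MeasurableSpace X] {ν : Measure X}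
  {L : FpCrossedProduct.{w} p α μ →ₙₐ[ℂ] (Lp ℂ p ν →L[ℂ] Lp ℂ p ν)}
  (hA : HasContractiveLeftApproxIdentity A)
  (hB : HasContractiveLeftApproxIdentity (FpCrossedProduct.{w} p α μ)) (hL : IsContractiveRep L)
  (hLn : IsNondegenerateRep L)

/-- The covariant representation underlying a nondegenerate contractive representation of
`F^p(G, A, α)`. -/
noncomputable def covariantRep : CovariantRep p α ν where
  π := coeffRep hB hL hLn
  contractive := isContractiveRep_coeffRep hB hL hLn
  nondegenerate := isNondegenerateRep_coeffRep hB hL hLn hA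
  v := groupRep hB hL hLn
  continuous_v := continuous_groupRep hB hL hLn
  covariant := groupRep_coeffRep_groupRep_inv hB hL hLn

theorem integrated_covariantRep (f : TwistedCc α μ) :
    (covariantRep hA hB hL hLn).integrated f = L (ofCc p α μ f) := by
  refine hLn.clm_ext fun y ξ => ?_
  calc (covariantRep hA hB hL hLn).integrated f (L y ξ)
      = ∫ t, L ((coeffMultiplier p α μ (f t)).1 ((groupMultiplier p α μ t).1 y)) ξ ∂μ := by
        simp only [CovariantRep.integrated_apply, ← coeffRep_groupRep_apply hB hL hLn]
        rfl
    _ = L (∫ t, (coeffMultiplier p α μ (f t)).1 ((groupMultiplier p α μ t).1 y) ∂μ) ξ :=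
        hL.integral_apply (integrable_coeffMultiplier_groupMultiplier f y) ξ
    _ = L (ofCc p α μ f) (L y ξ) := by
        rw [integral_coeffMultiplier_groupMultiplier, map_mul, mul_apply_eq_comp]

end FpCrossedProduct

end Disintegration

theorem theorem2p1_general {G : Type u} [Group G] [TopologicalSpace G] [IsTopologicalGroup G]
    [LocallyCompactSpace G] [MeasurableSpace G] [BorelSpace G]
    (μ : Measure G) [μ.IsHaarMeasure] (p : ℝ≥0∞) [Fact (1 ≤ p)]
    {A : Type v} [NonUnitalNormedRing A] [NormedSpace ℂ A] [IsScalarTower ℂ A A]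
    [SMulCommClass ℂ A A] [CompleteSpace A] (hA : HasContractiveLeftApproxIdentity A)
    (α : IsometricAction G A) {X : Type w} [MeasurableSpace X] (ν : Measure X) [SigmaFinite ν]
    (L : FpCrossedProduct.{w} p α μ →ₙₐ[ℂ] (Lp ℂ p ν →L[ℂ] Lp ℂ p ν))
    (hL : IsContractiveRep L) (hLn : IsNondegenerateRep L) :
    ∃ R : CovariantRep p α ν, L = R.integratedForm μ := by
  refine ⟨FpCrossedProduct.covariantRep hA
    (FpCrossedProduct.hasContractiveLeftApproxIdentity hA) hL hLn, NonUnitalAlgHom.ext fun y => ?_⟩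
  refine FpCrossedProduct.denseRange_ofCc.induction_on y
    (isClosed_eq hL.toCLM.continuous (CovariantRep.continuous_integratedForm _)) fun f => ?_
  rw [CovariantRep.integratedForm_ofCc, FpCrossedProduct.integrated_covariantRep]

theorem theorem2p1 {G : Type u} [Group G] [TopologicalSpace G] [IsTopologicalGroup G]
    [LocallyCompactSpace G] [MeasurableSpace G] [BorelSpace G]
    (μ : Measure G) [μ.IsHaarMeasure]
    (p : ℝ≥0∞) [Fact (1 ≤ p)] (hp : p ≠ ∞)
    {A : Type v} [NonUnitalNormedRing A] [NormedSpace ℂ A] [IsScalarTower ℂ A A]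
    [SMulCommClass ℂ A A] [CompleteSpace A]
    (hA : IsLpOperatorAlgebra.{x} p A) (hA_unit : HasContractiveApproxIdentity A)
    (α : IsometricAction G A)
    {X : Type w} [MeasurableSpace X] (ν : Measure X) [SigmaFinite ν]
    (L : FpCrossedProduct.{w} p α μ →ₙₐ[ℂ] (Lp ℂ p ν →L[ℂ] Lp ℂ p ν))
    (hL_contractive : IsContractiveRep L) (hL_nondegenerate : IsNondegenerateRep L) :
    ∃ R : CovariantRep p α ν, L = R.integratedForm μ :=
  theorem2p1_general μ p hA_unit.hasContractiveLeftApproxIdentity α ν L hL_contractive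
    hL_nondegenerate
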